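/- Let $\nu>-1$ and $0<q<1$. Put $(a;q)_n=\prod_{k=1}^{n}(1-aq^{k-1})$, $(a;q)_\infty=\prod_{k\ge1}(1-aq^{k-1})$, let $$J_\nu^{(3)}(z;q)=\frac{(q^{\nu+1};q)_\infty}{(q;q)_\infty}\sum_{n\ge0}\frac{(-1)^n z^{2n+\nu}}{(q;q)_n(q^{\nu+1};q)_n}\,q^{\frac12 n(n+1)}$$ be the Hahn-Exton $q$-Bessel function (principal powers), $c_\nu(q)=(q;q)_\infty/(q^{\nu+1};q)_\infty$, and $$g(z)=g_\nu^{(3)}(z;q)=c_\nu(q)\,z^{1-\nu}J_\nu^{(3)}(z;q),$$ an entire function with $g(0)=0$, $g'(0)=1$. Let $$r^*=\sup\Big\{r>0:\ \operatorname{Re}\frac{zg'(z)}{g(z)}>0\text{ for all }|z|<r\Big\}$$ be the radius of starlikeness of $g$ (the quotient has the value $1$ at $z=0$ by continuity). Then $r^*$ is the smallest positive root of the equation $$r\,\frac{dJ_\nu^{(3)}(r;q)}{dr}-(\nu-1)J_\nu^{(3)}(r;q)=0,$$ and it satisfies $$\sqrt{\frac{(1-q)(1-q^{\nu+1})}{3q}}<r^*<\sqrt{\frac{3(q^{\nu+1}-1)(q^{\nu+2}-1)(q^2-1)}{q(9q^{\nu+3}-q^{\nu+2}+q-9)}}$$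 and $$\sqrt[4]{\frac{(q^{\nu+1}-1)^2(q-1)^2(q^{\nu+2}-1)(q+1)}{q^2(9q^{\nu+3}-q^{\nu+2}+q-9)}}<r^*<\sqrt{\frac{(q-1)(q^{\nu+1}-1)(q^{\nu+3}-1)}{3q(q+1)}\,q_3^*(\nu)},$$ where $$q_3^*(\nu)=\frac{(9q^{\nu+3}-q^{\nu+2}+q-9)(q^3+2q^2+2q+1)}{s_\nu(q)+r_\nu(q)},$$ $$s_\nu(q)=6q^{\nu+2}-12q^{\nu+3}-20q^{\nu+4}-12q^{\nu+5}+6q^{\nu+6}+q^{2\nu+5},$$ $$r_\nu(q)=3q^{2\nu+6}+3q^{2\nu+7}+9q^{2\nu+8}+q^3+3q^2+3q+9.$$ Moreover, $g'$ belongs to the Laguerre-Pólya class (it is a limit, uniformly on compact subsets of $\mathbb{C}$, of real polynomials with only real zeros), and the sums $S_k=\sum_{\gamma}\gamma^{-2k}$ over the positive zeros $\gamma$ of $g'$, counted with multiplicity, converge for $k=1,2,3$ and have the values $$S_1=\frac{3q}{(1-q)(1-q^{\nu+1})},\qquad S_2=\frac{q^2(9q^{\nu+3}-q^{\nu+2}+q-9)}{(q^{\nu+1}-1)^2(q^{\nu+2}-1)(q-1)^2(q+1)},$$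 $$S_3=\frac{3q^3(9q^{\nu+3}-q^{\nu+2}+q-9)}{(q^{\nu+1}-1)^3(q^{\nu+2}-1)(q^{\nu+3}-1)(q-1)^3\,q_3^*(\nu)}.$$ -/

import Mathlib

open Filter Topology

noncomputable section

/-- The `q`-shifted factorial `(a; q)_n = ∏_{k=1}^{n} (1 - a q^{k-1})`. -/
def qPoch (a q : ℝ) (n : ℕ) : ℝ := ∏ k ∈ Finset.range n, (1 - a * q ^ k)

/-- The infinite product `(a; q)_∞ = ∏_{k ≥ 1} (1 - a q^{k-1})`. -/
def qPochInf (a q : ℝ) : ℝ := ∏' k : ℕ, (1 - a * q ^ k)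

/-- The Hahn-Exton `q`-Bessel function `J_ν^{(3)}(z; q)`, with principal complex powers. -/
def hahnExtonJ (ν q : ℝ) (z : ℂ) : ℂ :=
  ((qPochInf (q ^ (ν + 1)) q / qPochInf q q : ℝ) : ℂ) *
    ∑' n : ℕ, (((-1) ^ n * q ^ (n * (n + 1) / 2) /
      (qPoch q q n * qPoch (q ^ (ν + 1)) q n) : ℝ) : ℂ) * z ^ (((2 * n + ν : ℝ)) : ℂ)

/-- The normalizing constant `c_ν(q) = (q; q)_∞ / (q^{ν+1}; q)_∞`. -/
def cNu (ν q : ℝ) : ℝ := qPochInf q q / qPochInf (q ^ (ν + 1)) q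

/-- The normalized function `g_ν^{(3)}(z; q) = c_ν(q) z^{1-ν} J_ν^{(3)}(z; q)`.
(With Mathlib's convention for powers of `0` this formula takes at `z = 0` the value `0` for every
`ν > -1`, which is the value of the analytic extension.) -/
def gThree (ν q : ℝ) (z : ℂ) : ℂ :=
  (cNu ν q : ℂ) * z ^ (((1 - ν : ℝ)) : ℂ) * hahnExtonJ ν q z

/-- The radius of starlikeness of an analytic function `f` with `f 0 = 0`, `f' 0 = 1`: the supremum
of the `r > 0` with `Re (z f'(z) / f(z)) > 0` on the disk `|z| < r`. The point `z = 0`, at which the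
quotient extends analytically by the value `1`, is left out. (The supremum of an empty or an
unbounded set is `0` here, so a positive value is always a genuine supremum.) -/
def starlikenessRadius (f : ℂ → ℂ) : ℝ :=
  sSup {r : ℝ | 0 < r ∧ ∀ z : ℂ, ‖z‖ < r → z ≠ 0 → 0 < (z * deriv f z / f z).re}

/-- The Laguerre-Pólya class: limits, uniformly on compact sets, of real polynomials
all of whose complex zeros are real. -/
def LaguerrePolya (f : ℂ → ℂ) : Prop :=
  ∃ p : ℕ → Polynomial ℝ,
    (∀ n, ∀ z : ℂ, Polynomial.aeval z (p n) = 0 → z.im = 0) ∧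
    TendstoLocallyUniformly (fun n z => Polynomial.aeval z (p n)) f atTop

/-- `∑ γ^{-2k} = S`, where `γ` runs over the positive zeros of `f`, each repeated according to its
multiplicity; convergence of the sum is part of the claim. -/
def HasEulerRayleighSum (f : ℂ → ℂ) (k : ℕ) (S : ℝ) : Prop :=
  HasSum (fun γ : {γ : ℝ // 0 < γ ∧ f γ = 0} =>
    (analyticOrderNatAt f ((γ : ℝ) : ℂ) : ℝ) * ((γ : ℝ) ^ (2 * k))⁻¹) S

/-- The quantity `s_ν(q)`. -/
def sNu (ν q : ℝ) : ℝ :=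
  6 * q ^ (ν + 2) - 12 * q ^ (ν + 3) - 20 * q ^ (ν + 4) - 12 * q ^ (ν + 5) + 6 * q ^ (ν + 6)
    + q ^ (2 * ν + 5)

/-- The quantity `r_ν(q)`. -/
def rNu (ν q : ℝ) : ℝ :=
  3 * q ^ (2 * ν + 6) + 3 * q ^ (2 * ν + 7) + 9 * q ^ (2 * ν + 8) + q ^ 3 + 3 * q ^ 2 + 3 * q + 9

/-- The quantity `q_3^*(ν)`. -/
def qThreeStar (ν q : ℝ) : ℝ :=
  (9 * q ^ (ν + 3) - q ^ (ν + 2) + q - 9) * (q ^ 3 + 2 * q ^ 2 + 2 * q + 1) /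
    (sNu ν q + rNu ν q)

end

/-! Write b = q^(ν+1), so that g(z) = z F(z²) with F(w) = ∑ a_n w^n and a_n = `besselCoeff b q n`.
Everything follows from two genus-zero products with nonincreasing summable parameters, F(w) = ∏ (1
- y_m w) with y_m ≥ 0 and g'(z) = ∏ (1 - x_m z²) with x_m > 0.

F is the coefficientwise limit of rescaled Wall polynomials P. Their roots are real because P solves
a three-term recurrence with positive coefficients (`im_eq_zero_of_recurrence`), and positive
because the coefficients alternate in sign. Hence X P(X²) is real-rooted, and by Gauss–Lucas so is
its derivative (P + 2XP')(X²); these derivatives converge to g', which is the Laguerre–Pólya claim.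
`exists_tprod_of_tendsto_coeff` turns both limits into products: Gaussian decay of the coefficients,
uniform along the sequence, forces geometric decay of the reciprocal roots, so compactness and
dominated convergence pass the factorization and Newton's identities to the limit. The sums S_k = ∑
x_m^k, k ≤ 3, are thus explicit in a_1, a_2, a_3.

For the radius, z g'/g = 1 - 2 ∑ y_m z²/(1 - y_m z²), and each summand is bounded in modulus by its
value at |z|. The real part at z is therefore at least the quotient at |z|, which stays positive
until g' first vanishes on the positive axis: r* = x_0^(-1/2) (`starlikenessRadius_eq`). The four
bounds are x_0^k < S_k and S_(k+1) < x_0 S_k for k = 1, 2. -/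

/-! ### Real polynomials with positive roots -/

open Polynomial in
/-- A real polynomial with constant term `1` all of whose complex roots are positive reals is a
product `∏ (1 - x i X)` with a nonincreasing sequence `x` of nonnegative reals. -/
theorem exists_antitone_prod_of_pos_roots (p : Polynomial ℝ) (h0 : p.coeff 0 = 1)
    (hr : ∀ w : ℂ, aeval w p = 0 → w.im = 0 ∧ 0 < w.re) :
    ∃ (x : ℕ → ℝ) (N : ℕ), Antitone x ∧ (∀ i, 0 ≤ x i) ∧ (∀ i, N ≤ i → x i = 0) ∧
      p = ∏ i ∈ Finset.range N, (1 - C (x i) * X) := by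
  set P : Polynomial ℂ := p.map (algebraMap ℝ ℂ) with hP
  have hp0 : p ≠ 0 := by rintro rfl; simp at h0
  have hP0 : P ≠ 0 := (Polynomial.map_ne_zero_iff (algebraMap ℝ ℂ).injective).2 hp0
  have hroot : ∀ a ∈ P.roots, a.im = 0 ∧ 0 < a.re := by
    intro a ha
    apply hr
    have := (Polynomial.mem_roots hP0).1 ha
    rwa [IsRoot, hP, eval_map_algebraMap] at this
  set t : Multiset ℝ := P.roots.map (fun r => r.re⁻¹) with ht
  have htpos : ∀ a ∈ t, 0 < a := by
    intro a ha
    obtain ⟨r, hr, rfl⟩ := Multiset.mem_map.1 ha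
    exact inv_pos.2 (hroot r hr).2
  set l : List ℝ := t.sort (· ≥ ·) with hl
  have hlpos : ∀ a ∈ l, 0 < a := fun a ha => htpos a ((Multiset.mem_sort _).1 ha)
  have hsorted : l.Pairwise (· ≥ ·) := Multiset.pairwise_sort _ _
  have hnn : ∀ i, 0 ≤ l.getD i 0 := by
    intro i
    by_cases h : i < l.length
    · rw [List.getD_eq_getElem _ _ h]; exact (hlpos _ (List.getElem_mem h)).le
    · rw [List.getD_eq_default _ _ (not_lt.1 h)]
  -- The reciprocal roots in decreasing order, padded by zeros: the padding stays monotone since all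
  -- entries are positive.
  refine ⟨fun i => l.getD i 0, l.length, ?_, hnn, ?_, ?_⟩
  · intro i j hij
    rcases hij.eq_or_lt with rfl | hij
    · exact le_rfl
    by_cases h : j < l.length
    · have := List.pairwise_iff_getElem.1 hsorted i j (hij.trans h) h hij
      change l.getD j 0 ≤ l.getD i 0
      rwa [List.getD_eq_getElem _ _ h, List.getD_eq_getElem _ _ (hij.trans h)]
    · change l.getD j 0 ≤ l.getD i 0
      rw [List.getD_eq_default _ _ (not_lt.1 h)]
      exact hnn i
  · intro i hi
    exact List.getD_eq_default _ _ hi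
  · have hlist : ∏ i ∈ Finset.range l.length, (1 - C (l.getD i 0) * X)
        = (l.map (fun a => (1 - C a * X : Polynomial ℝ))).prod := by
      rw [← Fin.prod_univ_eq_prod_range (fun i => (1 - C (l.getD i 0) * X : Polynomial ℝ)),
        ← List.prod_ofFn]
      congr 1
      apply List.ext_getElem <;> simp
    rw [hlist]
    have hmul : (l.map (fun a => (1 - C a * X : Polynomial ℝ))).prod
        = (t.map (fun a => (1 - C a * X : Polynomial ℝ))).prod := by
      rw [← Multiset.prod_coe, ← Multiset.map_coe, hl, Multiset.sort_eq]
    rw [hmul]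
    apply Polynomial.map_injective (algebraMap ℝ ℂ) (algebraMap ℝ ℂ).injective
    rw [← hP, Polynomial.map_multiset_prod, ht, Multiset.map_map, Multiset.map_map]
    set Q := (Multiset.map ((Polynomial.map (algebraMap ℝ ℂ) ∘ fun a => 1 - C a * X) ∘
      fun r : ℂ => r.re⁻¹) P.roots).prod with hQ
    have hsplit := (IsAlgClosed.splits P).eq_prod_roots
    -- Each factor is X - a = -a (1 - a⁻¹ X). The constants collected here, together with the
    -- leading coefficient, multiply to 1, as evaluation at 0 shows.
    have hfac : (P.roots.map (fun a => X - C a)).prod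
        = C ((P.roots.map (fun a => -a)).prod) * Q := by
      rw [hQ, map_multiset_prod C, Multiset.map_map, ← Multiset.prod_map_mul]
      congr 1
      apply Multiset.map_congr rfl
      intro a ha
      obtain ⟨h1, h2⟩ := hroot a ha
      have ha' : ((a.re : ℝ) : ℂ) = a := by apply Complex.ext <;> simp [h1]
      have ha0 : a ≠ 0 := by rintro rfl; simp at h2
      have hX : C a * C a⁻¹ = 1 := by rw [← C_mul, mul_inv_cancel₀ ha0, C_1]
      simp only [Function.comp, Polynomial.map_sub, Polynomial.map_one, Polynomial.map_mul,
        Polynomial.map_C, Polynomial.map_X, Complex.coe_algebraMap, Complex.ofReal_inv, ha', C_neg]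
      linear_combination (-X) * hX
    rw [hfac, ← mul_assoc, ← C_mul] at hsplit
    set k := P.leadingCoeff * (P.roots.map (fun a => -a)).prod with hk
    have hQ0 : Q.eval 0 = 1 := by
      rw [hQ, Polynomial.eval_multiset_prod, Multiset.map_map]
      apply Multiset.prod_eq_one
      intro y hy
      obtain ⟨r, _, rfl⟩ := Multiset.mem_map.1 hy
      simp
    have hPe : P.eval 0 = 1 := by
      rw [← coeff_zero_eq_eval_zero, hP, coeff_map, h0, map_one]
    have hk1 : k = 1 := by
      have := congrArg (Polynomial.eval 0) hsplit
      rw [hPe, eval_mul, eval_C, hQ0, mul_one] at this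
      exact this.symm
    rw [hsplit, hk1, C_1, one_mul]

/-! ### Coefficients of `∏ (1 - x i X)` as signed elementary symmetric functions -/

section coeffs
open Polynomial

variable (x : ℕ → ℝ)

theorem coeff_succ_prod_range_succ (N m : ℕ) :
    (∏ i ∈ Finset.range (N + 1), (1 - C (x i) * X)).coeff (m + 1) =
      (∏ i ∈ Finset.range N, (1 - C (x i) * X)).coeff (m + 1) -
        x N * (∏ i ∈ Finset.range N, (1 - C (x i) * X)).coeff m := by
  rw [Finset.prod_range_succ, mul_sub, mul_one, coeff_sub, mul_comm (C (x N)) X, ← mul_assoc,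
    coeff_mul_C, coeff_mul_X, mul_comm]

theorem coeff_zero_prod_range (N : ℕ) :
    (∏ i ∈ Finset.range N, (1 - C (x i) * X)).coeff 0 = 1 := by
  rw [coeff_zero_eq_eval_zero, eval_prod]
  simp

theorem sign_coeff_prod_nonneg (hx : ∀ i, 0 ≤ x i) (N m : ℕ) :
    0 ≤ (-1) ^ m * (∏ i ∈ Finset.range N, (1 - C (x i) * X)).coeff m := by
  induction N generalizing m with
  | zero => cases m <;> simp [coeff_one]
  | succ N ih =>
    cases m with
    | zero => simp [coeff_zero_prod_range]
    | succ m =>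
      rw [coeff_succ_prod_range_succ]
      have h1 := ih (m + 1)
      have h2 := mul_nonneg (hx N) (ih m)
      rw [pow_succ] at *
      linarith

/-- The signed coefficient is the m-th elementary symmetric function, a sum of nonnegative terms,
one of which is the product of the first m parameters. This is how coefficient bounds control
individual roots. -/
theorem prod_le_sign_coeff_prod (hx : ∀ i, 0 ≤ x i) {N m : ℕ} (h : m ≤ N) :
    ∏ i ∈ Finset.range m, x i ≤
      (-1) ^ m * (∏ i ∈ Finset.range N, (1 - C (x i) * X)).coeff m := by
  induction N, h using Nat.le_induction with
  | base =>
    induction m with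
    | zero => simp
    | succ m ih =>
      rw [coeff_succ_prod_range_succ, Finset.prod_range_succ]
      have h1 := sign_coeff_prod_nonneg x hx m (m + 1)
      have h2 := mul_le_mul_of_nonneg_left ih (hx m)
      rw [pow_succ] at *
      linarith
  | succ N hN ih =>
    cases m with
    | zero => simp [coeff_zero_prod_range]
    | succ m =>
      rw [coeff_succ_prod_range_succ]
      have h2 := mul_nonneg (hx N) (sign_coeff_prod_nonneg x hx N m)
      rw [pow_succ] at *
      linarith

/-- Newton's identities in degrees one to three. -/
theorem newton_identities_prod_range (N : ℕ) :
    (∏ i ∈ Finset.range N, (1 - C (x i) * X)).coeff 1 = - ∑ i ∈ Finset.range N, x i ∧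
    2 * (∏ i ∈ Finset.range N, (1 - C (x i) * X)).coeff 2 =
      (∑ i ∈ Finset.range N, x i) ^ 2 - ∑ i ∈ Finset.range N, x i ^ 2 ∧
    6 * (∏ i ∈ Finset.range N, (1 - C (x i) * X)).coeff 3 =
      -(∑ i ∈ Finset.range N, x i) ^ 3 + 3 * (∑ i ∈ Finset.range N, x i) *
        (∑ i ∈ Finset.range N, x i ^ 2) - 2 * ∑ i ∈ Finset.range N, x i ^ 3 := by
  induction N with
  | zero => simp [coeff_one]
  | succ N ih =>
    obtain ⟨h1, h2, h3⟩ := ih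
    rw [coeff_succ_prod_range_succ, coeff_succ_prod_range_succ, coeff_succ_prod_range_succ,
      coeff_zero_prod_range]
    simp only [Finset.sum_range_succ, zero_add]
    refine ⟨by linear_combination h1, by linear_combination h2 - 2 * x N * h1,
      by linear_combination h3 - 3 * x N * h2⟩

end coeffs

/-! ### Limits of polynomials with positive roots -/

/-- A Gaussian-type sequence decays faster than any geometric one. -/
theorem summable_pow_mul_pow_mul_succ {D ρ : ℝ} (hD : 0 ≤ D) (hρ0 : 0 < ρ) (hρ1 : ρ < 1) {R : ℝ}
    (hR : 0 ≤ R) : Summable fun n : ℕ => D ^ n * ρ ^ (n * (n + 1)) * R ^ n := by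
  have hlim : Tendsto (fun n : ℕ => D * R * ρ ^ (n + 1)) atTop (𝓝 0) := by
    have := ((tendsto_pow_atTop_nhds_zero_of_lt_one hρ0.le hρ1).comp
      (tendsto_add_atTop_nat 1)).const_mul (D * R)
    simpa using this
  have hev : ∀ᶠ n : ℕ in atTop, D * R * ρ ^ (n + 1) ≤ 1 / 2 :=
    (hlim.eventually_lt_const (by norm_num : (0:ℝ) < 1 / 2)).mono fun n h => h.le
  refine Summable.of_norm_bounded_eventually_nat
    (g := fun n : ℕ => (1 / 2 : ℝ) ^ n) (summable_geometric_of_lt_one (by norm_num) (by norm_num)) ?_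
  filter_upwards [hev] with n hn
  -- Root test: the base of this n-th power tends to 0.
  have h : D ^ n * ρ ^ (n * (n + 1)) * R ^ n = (D * R * ρ ^ (n + 1)) ^ n := by
    rw [mul_pow, mul_pow, ← pow_mul, mul_comm (n + 1) n]; ring
  rw [h, Real.norm_of_nonneg (by positivity)]
  exact pow_le_pow_left₀ (by positivity) hn n

theorem aeval_eq_tsum_coeff (p : Polynomial ℝ) (w : ℂ) :
    Polynomial.aeval w p = ∑' n, ((p.coeff n : ℝ) : ℂ) * w ^ n := by
  rw [tsum_eq_sum (s := Finset.range (p.natDegree + 1)), Polynomial.aeval_eq_sum_range]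
  · simp
  · intro n hn
    rw [Polynomial.coeff_eq_zero_of_natDegree_lt (by simpa [Nat.lt_succ_iff] using hn)]
    simp

theorem aeval_eq_tprod {x : ℕ → ℝ} {N : ℕ} (hx : ∀ i, N ≤ i → x i = 0) (w : ℂ) :
    Polynomial.aeval w (∏ i ∈ Finset.range N, (1 - Polynomial.C (x i) * Polynomial.X)) =
      ∏' m, (1 - (x m : ℂ) * w) := by
  rw [tprod_eq_prod (s := Finset.range N)]
  · simp [map_prod]
  · intro i hi
    simp [hx i (by simpa using hi)]

theorem summable_pow_succ {D ρ : ℝ} (hρ0 : 0 < ρ) (hρ1 : ρ < 1) :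
    Summable fun m : ℕ => D * ρ ^ (m + 2) := by
  refine ((summable_geometric_of_lt_one hρ0.le hρ1).mul_left (D * ρ ^ 2)).congr fun m => ?_
  ring

/-- Convergence of power series with dominated coefficients. -/
theorem tendsto_tsum_coeff {A : ℕ → ℕ → ℝ} {a : ℕ → ℝ} {D ρ : ℝ} (hD : 0 ≤ D) (hρ0 : 0 < ρ)
    (hρ1 : ρ < 1) (hb : ∀ N n, |A N n| ≤ D ^ n * ρ ^ (n * (n + 1)))
    (ha : ∀ n, Tendsto (fun N => A N n) atTop (𝓝 (a n))) (w : ℂ) :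
    Tendsto (fun N => ∑' n, ((A N n : ℝ) : ℂ) * w ^ n) atTop (𝓝 (∑' n, ((a n : ℝ) : ℂ) * w ^ n)) := by
  refine tendsto_tsum_of_dominated_convergence
    (summable_pow_mul_pow_mul_succ hD hρ0 hρ1 (norm_nonneg w)) ?_ ?_
  · intro n
    exact ((Complex.continuous_ofReal.tendsto _).comp (ha n)).mul_const _
  · refine Eventually.of_forall fun N n => ?_
    rw [norm_mul, norm_pow, Complex.norm_real]
    exact mul_le_mul_of_nonneg_right (hb N n) (by positivity)

theorem abs_coeff_limit_le {A : ℕ → ℕ → ℝ} {a : ℕ → ℝ} {B : ℕ → ℝ}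
    (hb : ∀ N n, |A N n| ≤ B n) (ha : ∀ n, Tendsto (fun N => A N n) atTop (𝓝 (a n))) (n : ℕ) :
    |a n| ≤ B n :=
  le_of_tendsto (ha n).abs (Eventually.of_forall fun N => hb N n)

/-- If polynomials with positive roots and constant term `1` converge coefficientwise, with
coefficients of Gaussian decay, then the limit has a genus-zero factorization, and its first
power sums are given by Newton's identities. -/
theorem exists_tprod_of_tendsto_coeff (p : ℕ → Polynomial ℝ) (a : ℕ → ℝ) {D ρ : ℝ} (hD : 0 ≤ D)
    (hρ0 : 0 < ρ) (hρ1 : ρ < 1) (h0 : ∀ N, (p N).coeff 0 = 1)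
    (hr : ∀ N, ∀ w : ℂ, Polynomial.aeval w (p N) = 0 → w.im = 0 ∧ 0 < w.re)
    (hb : ∀ N n, |(p N).coeff n| ≤ D ^ n * ρ ^ (n * (n + 1)))
    (ha : ∀ n, Tendsto (fun N => (p N).coeff n) atTop (𝓝 (a n))) :
    ∃ x : ℕ → ℝ, Antitone x ∧ (∀ i, 0 ≤ x i) ∧ Summable x ∧
      (∀ w : ℂ, ∑' n, ((a n : ℝ) : ℂ) * w ^ n = ∏' m, (1 - (x m : ℂ) * w)) ∧
      ∑' m, x m = - a 1 ∧ ∑' m, x m ^ 2 = a 1 ^ 2 - 2 * a 2 ∧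
      ∑' m, x m ^ 3 = - a 1 ^ 3 + 3 * a 1 * a 2 - 3 * a 3 := by
  choose y M hanti hnn hzero hprod using fun N => exists_antitone_prod_of_pos_roots (p N) (h0 N) (hr N)
  -- By monotonicity y_m^(m+1) ≤ y_0 ⋯ y_m, which is at most the modulus of the coefficient of
  -- degree m+1, hence at most D^(m+1) ρ^((m+1)(m+2)); take the (m+1)-th root.
  have hbd : ∀ N m, y N m ≤ D * ρ ^ (m + 2) := by
    intro N m
    by_cases hm : m + 1 ≤ M N
    · have h1 : y N m ^ (m + 1) ≤ ∏ i ∈ Finset.range (m + 1), y N i := by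
        rw [← Finset.card_range (m + 1), ← Finset.prod_const, Finset.card_range]
        refine Finset.prod_le_prod (fun i _ => hnn N m) fun i hi => hanti N ?_
        have := Finset.mem_range.1 hi; omega
      have h2 := prod_le_sign_coeff_prod (y N) (hnn N) hm
      rw [← hprod N] at h2
      have h3 : (-1 : ℝ) ^ (m + 1) * (p N).coeff (m + 1) ≤ |(p N).coeff (m + 1)| := by
        refine (le_abs_self _).trans ?_
        rw [abs_mul, abs_pow, abs_neg, abs_one, one_pow, one_mul]
      have h4 : y N m ^ (m + 1) ≤ (D * ρ ^ (m + 2)) ^ (m + 1) := by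
        refine (h1.trans (h2.trans (h3.trans (hb N (m + 1))))).trans_eq ?_
        rw [mul_pow, ← pow_mul]; ring
      exact le_of_pow_le_pow_left₀ (Nat.succ_ne_zero m) (by positivity) h4
    · rw [hzero N m (by omega)]; positivity
  have hsum := summable_pow_succ (D := D) hρ0 hρ1
  -- A limit along an ultrafilter finer than `atTop` replaces a diagonal subsequence; it exists for
  -- all m at once.
  have hlim : ∀ m, ∃ c ∈ Set.Icc 0 (D * ρ ^ (m + 2)),
      Tendsto (fun N => y N m) (hyperfilter ℕ : Filter ℕ) (𝓝 c) := by
    intro m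
    have hmem : Set.Icc 0 (D * ρ ^ (m + 2)) ∈ (hyperfilter ℕ).map (fun N => y N m) :=
      Filter.mem_map.2 (Filter.univ_mem' fun N => ⟨hnn N m, hbd N m⟩)
    exact (isCompact_Icc (a := (0:ℝ)) (b := D * ρ ^ (m + 2))).ultrafilter_le_nhds'
      ((hyperfilter ℕ).map (fun N => y N m)) hmem
  choose x hxmem hx using hlim
  have hle := Nat.hyperfilter_le_atTop
  have hpow : ∀ k, 1 ≤ k → Tendsto (fun N => ∑' m, y N m ^ k) (hyperfilter ℕ : Filter ℕ)
      (𝓝 (∑' m, x m ^ k)) := by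
    intro k hk
    have hs : Summable fun m : ℕ => (D * ρ ^ (m + 2)) ^ k := by
      have : Summable fun m : ℕ => (D * ρ ^ 2) ^ k * (ρ ^ k) ^ m :=
        (summable_geometric_of_lt_one (by positivity)
          (pow_lt_one₀ hρ0.le hρ1 (by omega))).mul_left _
      refine this.congr fun m => ?_
      rw [← pow_mul, mul_comm k m, pow_mul, ← mul_pow]; ring
    refine tendsto_tsum_of_dominated_convergence hs (fun m => (hx m).pow k)
      (Eventually.of_forall fun N m => ?_)
    rw [norm_pow, Real.norm_of_nonneg (hnn N m)]
    exact pow_le_pow_left₀ (hnn N m) (hbd N m) k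
  have hfin : ∀ N k, 1 ≤ k → ∑' m, y N m ^ k = ∑ m ∈ Finset.range (M N), y N m ^ k := by
    intro N k hk
    refine tsum_eq_sum fun m hm => ?_
    rw [hzero N m (by simpa using hm), zero_pow (by omega)]
  have hnewton := fun N => newton_identities_prod_range (y N) (M N)
  simp_rw [← hprod] at hnewton
  have hS1 : ∑' m, x m = - a 1 := by
    have h := hpow 1 le_rfl
    simp only [pow_one] at h
    refine tendsto_nhds_unique h (((ha 1).mono_left hle).neg.congr fun N => ?_)
    have := hfin N 1 le_rfl
    simp only [pow_one] at this
    rw [this]; linarith [(hnewton N).1]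
  have hS2 : ∑' m, x m ^ 2 = a 1 ^ 2 - 2 * a 2 := by
    refine tendsto_nhds_unique (hpow 2 (by norm_num))
      (((((ha 1).pow 2).sub ((ha 2).const_mul 2)).mono_left hle).congr fun N => ?_)
    rw [hfin N 2 (by norm_num), (hnewton N).1, (hnewton N).2.1]; ring
  have hS3 : ∑' m, x m ^ 3 = - a 1 ^ 3 + 3 * a 1 * a 2 - 3 * a 3 := by
    refine tendsto_nhds_unique (hpow 3 (by norm_num))
      ((((((ha 1).pow 3).neg.add (((ha 1).const_mul 3).mul (ha 2))).sub
        ((ha 3).const_mul 3)).mono_left hle).congr fun N => ?_)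
    rw [hfin N 3 (by norm_num)]
    obtain ⟨e1, e2, e3⟩ := hnewton N
    rw [e1]
    linear_combination (-3 / 2 * ∑ i ∈ Finset.range (M N), y N i) * e2 - 1 / 2 * e3
  refine ⟨x, ?_, fun i => (hxmem i).1, ?_, ?_, hS1, hS2, hS3⟩
  · intro i j hij
    exact le_of_tendsto_of_tendsto (hx j) (hx i) (Eventually.of_forall fun N => hanti N hij)
  · exact Summable.of_nonneg_of_le (fun m => (hxmem m).1) (fun m => (hxmem m).2) hsum
  · intro w
    have h1 := (tendsto_tsum_coeff hD hρ0 hρ1 hb ha w).mono_left hle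
    have h2 : Tendsto (fun N => ∏' m, (1 + (-((y N m : ℝ) : ℂ) * w))) (hyperfilter ℕ : Filter ℕ)
        (𝓝 (∏' m, (1 + (-((x m : ℝ) : ℂ) * w)))) := by
      refine tendsto_tprod_one_add_of_dominated_convergence (hsum.mul_right ‖w‖) ?_ ?_
      · intro m
        exact (((Complex.continuous_ofReal.tendsto _).comp (hx m)).neg).mul_const _
      · refine Eventually.of_forall fun N m => ?_
        rw [norm_mul, norm_neg, Complex.norm_real, Real.norm_of_nonneg (hnn N m)]
        exact mul_le_mul_of_nonneg_right (hbd N m) (norm_nonneg w)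
    simp only [neg_mul, ← sub_eq_add_neg] at h2
    refine tendsto_nhds_unique (h1.congr fun N => ?_) h2
    rw [← aeval_eq_tsum_coeff, hprod N, aeval_eq_tprod (hzero N)]

/-! ### The Wall polynomials -/

/-- The coefficients of the Wall (little `q`-Laguerre) polynomials, in the variable `y = q ^ n`. -/
noncomputable def wallCoeff (b q y : ℝ) (k : ℕ) : ℝ :=
  (∏ j ∈ Finset.range k, (1 - q ^ j / y)) * q ^ k / (qPoch q q k * qPoch b q k)

/-- The Wall polynomial `₂φ₁(q⁻ⁿ, 0; b; q; q x)`. -/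
noncomputable def wallPoly (b q : ℝ) (n : ℕ) : Polynomial ℝ :=
  ∑ k ∈ Finset.range (n + 1), Polynomial.C (wallCoeff b q (q ^ n) k) * Polynomial.X ^ k

theorem one_sub_mul_pow_pos {a q : ℝ} (ha : a < 1) (hq0 : 0 < q) (hq1 : q < 1) (j : ℕ) :
    0 < 1 - a * q ^ j := by
  have h1 : q ^ j ≤ 1 := pow_le_one₀ hq0.le hq1.le
  have h2 : 0 < q ^ j := pow_pos hq0 j
  nlinarith

theorem qPoch_pos {a q : ℝ} (ha : a < 1) (hq0 : 0 < q) (hq1 : q < 1) (n : ℕ) :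
    0 < qPoch a q n :=
  Finset.prod_pos fun j _ => one_sub_mul_pow_pos ha hq0 hq1 j

theorem qPoch_succ (a q : ℝ) (n : ℕ) : qPoch a q (n + 1) = qPoch a q n * (1 - a * q ^ n) :=
  Finset.prod_range_succ _ _

theorem pow_le_qPoch {a q : ℝ} (ha0 : 0 < a) (ha : a < 1) (hq0 : 0 < q) (hq1 : q < 1) (n : ℕ) :
    (1 - a) ^ n ≤ qPoch a q n := by
  have := Finset.prod_le_prod (s := Finset.range n) (f := fun _ => 1 - a)
    (g := fun j => 1 - a * q ^ j) (fun _ _ => by linarith) (fun j _ => by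
      have h1 : q ^ j ≤ 1 := pow_le_one₀ hq0.le hq1.le
      nlinarith)
  simpa [qPoch] using this

theorem wallCoeff_zero (b q y : ℝ) : wallCoeff b q y 0 = 1 := by
  simp [wallCoeff, qPoch]

theorem wallCoeff_eq_zero_of_lt {q : ℝ} (b : ℝ) (hq0 : 0 < q) {n k : ℕ} (h : n < k) :
    wallCoeff b q (q ^ n) k = 0 := by
  have : ∏ j ∈ Finset.range k, (1 - q ^ j / q ^ n) = 0 :=
    Finset.prod_eq_zero (Finset.mem_range.2 h) (by rw [div_self (pow_pos hq0 n).ne', sub_self])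
  rw [wallCoeff, this, zero_mul, zero_div]

theorem coeff_wallPoly {q : ℝ} (b : ℝ) (hq0 : 0 < q) (n k : ℕ) :
    (wallPoly b q n).coeff k = wallCoeff b q (q ^ n) k := by
  simp only [wallPoly, Polynomial.finsetSum_coeff, Polynomial.coeff_C_mul_X_pow]
  rw [Finset.sum_ite_eq]
  split_ifs with h
  · rfl
  · rw [wallCoeff_eq_zero_of_lt b hq0 (by simpa using h)]

/-- At y = q^n the shifts y q and y / q are the indices n + 1 and n - 1, so this q-difference
equation in y is the three-term recurrence read off coefficient by coefficient; the index k on the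
left comes from multiplication by X. -/
theorem wallCoeff_recurrence {b q y : ℝ} (hb : b < 1) (hq0 : 0 < q) (hq1 : q < 1) (hy : y ≠ 0)
    (k : ℕ) :
    -wallCoeff b q y k = y * (1 - b * y) * (wallCoeff b q (y * q) (k + 1) - wallCoeff b q y (k + 1))
      + b / q * y * (1 - y) * (wallCoeff b q (y / q) (k + 1) - wallCoeff b q y (k + 1)) := by
  have hq : q ≠ 0 := hq0.ne'
  set E := ∏ j ∈ Finset.range k, (1 - q ^ j / y) with hE
  have e1 : ∏ j ∈ Finset.range (k + 1), (1 - q ^ j / y) = E * (1 - q ^ k / y) :=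
    Finset.prod_range_succ _ _
  have e2 : ∏ j ∈ Finset.range (k + 1), (1 - q ^ j / (y * q)) = E * (1 - 1 / (y * q)) := by
    rw [Finset.prod_range_succ', pow_zero, hE]
    congr 1
    refine Finset.prod_congr rfl fun j _ => ?_
    rw [pow_succ, mul_div_mul_right _ _ hq]
  -- The shifted product lacks the factor 1 - 1/y of the original one. Carrying 1 - y = -y (1 - 1/y)
  -- along avoids a division that would fail at y = 1.
  have e3 : (1 - y) * ∏ j ∈ Finset.range (k + 1), (1 - q ^ j / (y / q)) =
      -y * (E * (1 - q ^ k / y) * (1 - q ^ (k + 1) / y)) := by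
    have : E * (1 - q ^ k / y) * (1 - q ^ (k + 1) / y) =
        (∏ j ∈ Finset.range (k + 1), (1 - q ^ j / (y / q))) * (1 - 1 / y) := by
      rw [← e1, ← Finset.prod_range_succ (fun j => 1 - q ^ j / y), Finset.prod_range_succ',
        pow_zero]
      congr 1
      refine Finset.prod_congr rfl fun j _ => ?_
      rw [pow_succ, div_div_eq_mul_div]
    have hy1 : 1 - y = -y * (1 - 1 / y) := by field_simp; ring
    rw [this, hy1]
    ring
  have h1 : qPoch q q k ≠ 0 := (qPoch_pos hq1 hq0 hq1 k).ne'
  have h2 : qPoch b q k ≠ 0 := (qPoch_pos hb hq0 hq1 k).ne'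
  have h3 : 1 - q * q ^ k ≠ 0 := (one_sub_mul_pow_pos hq1 hq0 hq1 k).ne'
  have h4 : 1 - b * q ^ k ≠ 0 := (one_sub_mul_pow_pos hb hq0 hq1 k).ne'
  have e4 : b / q * y * (1 - y) * wallCoeff b q (y / q) (k + 1) =
      b / q * y * (-y * (E * (1 - q ^ k / y) * (1 - q ^ (k + 1) / y))) * q ^ (k + 1) /
        (qPoch q q (k + 1) * qPoch b q (k + 1)) := by
    rw [wallCoeff, ← e3]; ring
  rw [mul_sub (b / q * y * (1 - y)), e4]
  simp only [wallCoeff, e1, e2, ← hE, qPoch_succ]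
  rw [pow_succ]
  generalize q ^ k = K at h3 h4 ⊢
  generalize qPoch q q k = Q at h1 ⊢
  generalize qPoch b q k = B at h2 ⊢
  generalize hu : 1 - q * K = u at h3 ⊢
  generalize hv : 1 - b * K = v at h4 ⊢
  field_simp
  rw [← hu, ← hv]
  ring

theorem wallPoly_recurrence {b q : ℝ} (hb : b < 1) (hq0 : 0 < q) (hq1 : q < 1) (n : ℕ) :
    -(Polynomial.X * wallPoly b q (n + 1)) =
      Polynomial.C (q ^ (n + 1) * (1 - b * q ^ (n + 1))) *
        (wallPoly b q (n + 2) - wallPoly b q (n + 1)) +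
      Polynomial.C (b / q * q ^ (n + 1) * (1 - q ^ (n + 1))) *
        (wallPoly b q n - wallPoly b q (n + 1)) := by
  ext k
  cases k with
  | zero => simp [coeff_wallPoly b hq0, wallCoeff_zero, Polynomial.mul_coeff_zero]
  | succ k =>
    have := wallCoeff_recurrence hb hq0 hq1 (pow_pos hq0 (n + 1)).ne' k
    rw [← pow_succ, pow_succ q n, mul_div_cancel_right₀ _ hq0.ne', ← pow_succ] at this
    simpa only [Polynomial.coeff_neg, Polynomial.coeff_X_mul, Polynomial.coeff_add,
      Polynomial.coeff_C_mul, Polynomial.coeff_sub, coeff_wallPoly b hq0] using this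

/-- At y = 1 the factor 1 - y removes the lower neighbour, which supplies the initial condition of
the recurrence. -/
theorem wallPoly_recurrence_zero {b q : ℝ} (hb : b < 1) (hq0 : 0 < q) (hq1 : q < 1) :
    -(Polynomial.X * wallPoly b q 0) =
      Polynomial.C (1 - b) * (wallPoly b q 1 - wallPoly b q 0) := by
  ext k
  cases k with
  | zero => simp [coeff_wallPoly b hq0, wallCoeff_zero, Polynomial.mul_coeff_zero]
  | succ k =>
    have := wallCoeff_recurrence hb hq0 hq1 one_ne_zero k
    rw [Polynomial.coeff_neg, Polynomial.coeff_X_mul, Polynomial.coeff_C_mul,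
      Polynomial.coeff_sub]
    simpa [coeff_wallPoly b hq0] using this

/-- Spectral parameters of a three-term recurrence at which a solution vanishes are real. -/
theorem im_eq_zero_of_recurrence {A B : ℕ → ℝ} (hA : ∀ n, 0 < A n) (hB : ∀ n, 0 < B n)
    {p : ℕ → ℂ} {x : ℂ} (h0 : -(x * p 0) = A 0 * (p 1 - p 0))
    (h : ∀ n, -(x * p (n + 1)) = A (n + 1) * (p (n + 2) - p (n + 1)) + B n * (p n - p (n + 1)))
    (hp : p 0 ≠ 0) {N : ℕ} (hN : p (N + 1) = 0) : x.im = 0 := by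
  -- Christoffel–Darboux for p and its conjugate: the bracket is the discrete Wronskian Im(p_(n+1)
  -- p̄_n), and S is a sum of |p_k|² with weights built from the ratios B/A, positive because p 0 ≠
  -- 0. If p (N+1) = 0 the left side vanishes, so Im x = 0.
  have key : ∀ n, ∃ S : ℝ, 0 < S ∧
      A n * ((p (n + 1)).im * (p n).re - (p (n + 1)).re * (p n).im) = -x.im * S := by
    intro n
    induction n with
    | zero =>
      refine ⟨Complex.normSq (p 0), Complex.normSq_pos.2 hp, ?_⟩
      have hre := congrArg Complex.re h0
      have him := congrArg Complex.im h0
      simp only [Complex.neg_re, Complex.neg_im, Complex.mul_re, Complex.mul_im, Complex.sub_re,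
        Complex.sub_im, Complex.ofReal_re, Complex.ofReal_im, zero_mul, sub_zero, add_zero]
        at hre him
      rw [Complex.normSq_apply]
      linear_combination (p 0).im * hre - (p 0).re * him
    | succ n ih =>
      obtain ⟨S, hS, hSe⟩ := ih
      refine ⟨Complex.normSq (p (n + 1)) + B n / A n * S, ?_, ?_⟩
      · have := mul_pos (div_pos (hB n) (hA n)) hS
        linarith [Complex.normSq_nonneg (p (n + 1))]
      · have hre := congrArg Complex.re (h n)
        have him := congrArg Complex.im (h n)
        simp only [Complex.neg_re, Complex.neg_im, Complex.mul_re, Complex.mul_im, Complex.sub_re,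
          Complex.sub_im, Complex.ofReal_re, Complex.ofReal_im, zero_mul, sub_zero, add_zero,
          Complex.add_re, Complex.add_im] at hre him
        rw [Complex.normSq_apply]
        have hAn := (hA n).ne'
        have hD : (p (n + 1)).im * (p n).re - (p (n + 1)).re * (p n).im = -x.im * S / A n := by
          rw [eq_div_iff hAn]; linear_combination hSe
        linear_combination (p (n + 1)).im * hre - (p (n + 1)).re * him + B n * hD
  obtain ⟨S, hS, hSe⟩ := key N
  rw [hN] at hSe
  simp only [Complex.zero_im, Complex.zero_re, zero_mul, sub_zero, mul_zero] at hSe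
  rcases mul_eq_zero.1 hSe.symm with h | h
  · linarith
  · exact absurd h hS.ne'

theorem sign_wallCoeff_nonneg {b q : ℝ} (hb : b < 1) (hq0 : 0 < q) (hq1 : q < 1) (n k : ℕ) :
    0 ≤ (-1) ^ k * wallCoeff b q (q ^ n) k := by
  by_cases h : n < k
  · rw [wallCoeff_eq_zero_of_lt b hq0 h, mul_zero]
  · have e : (-1 : ℝ) ^ k * wallCoeff b q (q ^ n) k =
        (∏ j ∈ Finset.range k, (q ^ j / q ^ n - 1)) * q ^ k / (qPoch q q k * qPoch b q k) := by
      rw [wallCoeff, ← Finset.card_range k, ← Finset.prod_const, Finset.card_range, ← mul_div_assoc,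
        ← mul_assoc, ← Finset.prod_mul_distrib]
      simp
    rw [e]
    have h1 := qPoch_pos hq1 hq0 hq1 k
    have h2 := qPoch_pos hb hq0 hq1 k
    have h3 : 0 ≤ ∏ j ∈ Finset.range k, (q ^ j / q ^ n - 1) := by
      refine Finset.prod_nonneg fun j hj => ?_
      rw [sub_nonneg, le_div_iff₀ (pow_pos hq0 n), one_mul]
      exact pow_le_pow_of_le_one hq0.le hq1.le (by have := Finset.mem_range.1 hj; omega)
    positivity

/-- A real polynomial with alternating coefficients and constant term `1` has no root `≤ 0`. -/
theorem pos_of_real_root {p : Polynomial ℝ} (h0 : p.coeff 0 = 1)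
    (hs : ∀ k, 0 ≤ (-1) ^ k * p.coeff k) {r : ℝ} (hr : p.eval r = 0) : 0 < r := by
  by_contra hneg
  rw [Polynomial.eval_eq_sum_range, Finset.sum_range_succ', h0] at hr
  -- For r ≤ 0 the signs of the coefficients and of the powers cancel, so the polynomial is at least
  -- its constant term 1.
  have : 0 ≤ ∑ k ∈ Finset.range p.natDegree, p.coeff (k + 1) * r ^ (k + 1) := by
    refine Finset.sum_nonneg fun k _ => ?_
    have e : p.coeff (k + 1) * r ^ (k + 1) = (-1) ^ (k + 1) * p.coeff (k + 1) * (-r) ^ (k + 1) := by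
      rw [neg_pow r]
      have : ((-1 : ℝ) ^ (k + 1)) * (-1) ^ (k + 1) = 1 := by
        rw [← mul_pow]; norm_num
      linear_combination (-(p.coeff (k + 1) * r ^ (k + 1))) * this
    rw [e]
    exact mul_nonneg (hs _) (pow_nonneg (by linarith) _)
  simp at hr
  linarith

theorem wallPoly_roots {b q : ℝ} (hb0 : 0 < b) (hb : b < 1) (hq0 : 0 < q) (hq1 : q < 1) (n : ℕ)
    {w : ℂ} (hw : Polynomial.aeval w (wallPoly b q n) = 0) : w.im = 0 ∧ 0 < w.re := by
  have him : w.im = 0 := by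
    cases n with
    | zero => simp [wallPoly, wallCoeff_zero] at hw
    | succ n =>
      refine im_eq_zero_of_recurrence (A := fun n => q ^ n * (1 - b * q ^ n))
        (B := fun n => b / q * q ^ (n + 1) * (1 - q ^ (n + 1)))
        (p := fun n => Polynomial.aeval w (wallPoly b q n)) (fun n => ?_) (fun n => ?_) ?_
        (fun n => ?_) ?_ hw
      · exact mul_pos (pow_pos hq0 n) (one_sub_mul_pow_pos hb hq0 hq1 n)
      · have : q ^ (n + 1) < 1 := pow_lt_one₀ hq0.le hq1 (Nat.succ_ne_zero n)
        have : 0 < 1 - q ^ (n + 1) := by linarith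
        positivity
      · simpa using congrArg (Polynomial.aeval w) (wallPoly_recurrence_zero hb hq0 hq1)
      · simpa using congrArg (Polynomial.aeval w) (wallPoly_recurrence hb hq0 hq1 n)
      · simp [wallPoly, wallCoeff_zero]
  refine ⟨him, pos_of_real_root (p := wallPoly b q n) ?_ ?_ ?_⟩
  · rw [coeff_wallPoly b hq0, wallCoeff_zero]
  · intro k
    rw [coeff_wallPoly b hq0]
    exact sign_wallCoeff_nonneg hb hq0 hq1 n k
  · have hw' : w = ((w.re : ℝ) : ℂ) := by apply Complex.ext <;> simp [him]
    rw [hw'] at hw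
    have := Polynomial.aeval_algebraMap_apply ℂ w.re (wallPoly b q n)
    rw [Complex.coe_algebraMap, hw] at this
    simpa using this.symm

/-! ### Rescaled Wall polynomials and their limits -/

/-- The Wall polynomial in the variable `q ^ n x`. -/
noncomputable def scaledWallPoly (b q : ℝ) (n : ℕ) : Polynomial ℝ :=
  (wallPoly b q n).comp (Polynomial.C (q ^ n) * Polynomial.X)

/-- The Taylor coefficients of `∑ (-1)^n q^{n(n+1)/2} w^n / ((q;q)_n (b;q)_n)`. -/
noncomputable def besselCoeff (b q : ℝ) (n : ℕ) : ℝ :=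
  (-1) ^ n * q ^ (n * (n + 1) / 2) / (qPoch q q n * qPoch b q n)

theorem prod_pow_succ (q : ℝ) (k : ℕ) :
    ∏ j ∈ Finset.range k, q ^ (j + 1) = q ^ (k * (k + 1) / 2) := by
  induction k with
  | zero => simp
  | succ k ih =>
    rw [Finset.prod_range_succ, ih, ← pow_add]
    congr 1
    have : (k + 1) * (k + 1 + 1) = k * (k + 1) + (k + 1) * 2 := by ring
    rw [this, Nat.add_mul_div_right _ _ (by norm_num)]

theorem coeff_scaledWallPoly {q : ℝ} (b : ℝ) (hq0 : 0 < q) (n k : ℕ) :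
    (scaledWallPoly b q n).coeff k =
      (∏ j ∈ Finset.range k, (q ^ n - q ^ j)) * q ^ k / (qPoch q q k * qPoch b q k) := by
  have h : (∏ j ∈ Finset.range k, (1 - q ^ j / q ^ n)) * (q ^ n) ^ k =
      ∏ j ∈ Finset.range k, (q ^ n - q ^ j) := by
    induction k with
    | zero => simp
    | succ k ih =>
      rw [Finset.prod_range_succ, Finset.prod_range_succ, ← ih]
      have h : (1 - q ^ k / q ^ n) * q ^ n = q ^ n - q ^ k := by
        rw [sub_mul, one_mul, div_mul_cancel₀ _ (pow_pos hq0 n).ne']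
      rw [← h]
      ring
  rw [scaledWallPoly, Polynomial.comp_C_mul_X_coeff, coeff_wallPoly b hq0, wallCoeff, ← h]
  ring

/-- The rescaling turns the factors 1 - q^j/q^n, which blow up, into q^n - q^j, which tend to -q^j.
-/
theorem tendsto_coeff_scaledWallPoly {q : ℝ} (b : ℝ) (hq0 : 0 < q) (hq1 : q < 1) (k : ℕ) :
    Tendsto (fun n => (scaledWallPoly b q n).coeff k) atTop (𝓝 (besselCoeff b q k)) := by
  simp_rw [coeff_scaledWallPoly b hq0]
  have h1 : Tendsto (fun n : ℕ => ∏ j ∈ Finset.range k, (q ^ n - q ^ j)) atTop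
      (𝓝 (∏ j ∈ Finset.range k, (0 - q ^ j))) :=
    tendsto_finsetProd _ fun j _ =>
      (tendsto_pow_atTop_nhds_zero_of_lt_one hq0.le hq1).sub_const _
  have e : besselCoeff b q k =
      (∏ j ∈ Finset.range k, (0 - q ^ j)) * q ^ k / (qPoch q q k * qPoch b q k) := by
    rw [besselCoeff, ← prod_pow_succ]
    congr 1
    rw [← Finset.card_range k, ← Finset.prod_const, ← Finset.prod_const, Finset.card_range,
      ← Finset.prod_mul_distrib, ← Finset.prod_mul_distrib]
    refine Finset.prod_congr rfl fun j _ => ?_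
    ring
  rw [e]
  exact (h1.mul_const _).div_const _

/-- For k ≤ n each |q^n - q^j| is at most q^j, and for k > n the coefficient vanishes, so the bound
is uniform in n. Taking √q as base keeps the exponent k(k+1) free of a halving. -/
theorem abs_coeff_scaledWallPoly_le {b q : ℝ} (hb0 : 0 < b) (hb : b < 1) (hq0 : 0 < q)
    (hq1 : q < 1) (n k : ℕ) :
    |(scaledWallPoly b q n).coeff k| ≤ (1 / ((1 - q) * (1 - b))) ^ k * √q ^ (k * (k + 1)) := by
  have h1 := pow_le_qPoch hq0 hq1 hq0 hq1 k
  have h2 := pow_le_qPoch hb0 hb hq0 hq1 k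
  have p1 := qPoch_pos hq1 hq0 hq1 k
  have p2 := qPoch_pos hb hq0 hq1 k
  have c1 : 0 < (1 - q) ^ k := pow_pos (by linarith) k
  have c2 : 0 < (1 - b) ^ k := pow_pos (by linarith) k
  have e : √q ^ (k * (k + 1)) = ∏ j ∈ Finset.range k, q ^ (j + 1) := by
    rw [prod_pow_succ]
    obtain ⟨m, hm⟩ := (Nat.even_mul_succ_self k)
    rw [hm, ← two_mul, Nat.mul_div_cancel_left _ (by norm_num), pow_mul, Real.sq_sqrt hq0.le]
  have e2 : ∏ j ∈ Finset.range k, q ^ (j + 1) = (∏ j ∈ Finset.range k, q ^ j) * q ^ k := by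
    simp [pow_succ, Finset.prod_mul_distrib]
  rw [coeff_scaledWallPoly b hq0, abs_div, abs_mul, Finset.abs_prod, abs_of_pos (mul_pos p1 p2),
    abs_of_pos (pow_pos hq0 k), e, e2, one_div, inv_pow, mul_pow, div_eq_inv_mul]
  have hprod : ∏ j ∈ Finset.range k, |q ^ n - q ^ j| ≤ ∏ j ∈ Finset.range k, q ^ j := by
    by_cases h : k ≤ n
    · refine Finset.prod_le_prod (fun j _ => abs_nonneg _) fun j hj => ?_
      have hj' := Finset.mem_range.1 hj
      have : q ^ n ≤ q ^ j := pow_le_pow_of_le_one hq0.le hq1.le (by omega)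
      rw [abs_of_nonpos (by linarith)]
      linarith [pow_pos hq0 n]
    · rw [Finset.prod_eq_zero (Finset.mem_range.2 (not_le.1 h)) (by simp)]
      positivity
  gcongr

theorem coeff_zero_scaledWallPoly {q : ℝ} (b : ℝ) (hq0 : 0 < q) (n : ℕ) :
    (scaledWallPoly b q n).coeff 0 = 1 := by
  simp [coeff_scaledWallPoly b hq0, qPoch]

theorem scaledWallPoly_roots {b q : ℝ} (hb0 : 0 < b) (hb : b < 1) (hq0 : 0 < q) (hq1 : q < 1)
    (n : ℕ) {w : ℂ} (hw : Polynomial.aeval w (scaledWallPoly b q n) = 0) :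
    w.im = 0 ∧ 0 < w.re := by
  have hq := pow_pos hq0 n
  rw [scaledWallPoly, Polynomial.aeval_comp] at hw
  obtain ⟨h1, h2⟩ := wallPoly_roots hb0 hb hq0 hq1 n hw
  simp only [map_mul, Polynomial.aeval_C, Polynomial.aeval_X, Complex.coe_algebraMap,
    Complex.re_ofReal_mul, Complex.im_ofReal_mul] at h1 h2
  exact ⟨(mul_eq_zero.1 h1).resolve_left hq.ne', pos_of_mul_pos_right h2 hq.le⟩

/-! ### Passing to the derivative -/

/-- The polynomial `P + 2 X P'`; it satisfies `(P + 2 X P')(z ^ 2) = (z P(z ^ 2))'`. -/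
noncomputable def oddDerivative (P : Polynomial ℝ) : Polynomial ℝ :=
  P + 2 * Polynomial.X * Polynomial.derivative P

theorem coeff_oddDerivative (P : Polynomial ℝ) (k : ℕ) :
    (oddDerivative P).coeff k = (2 * k + 1) * P.coeff k := by
  rw [oddDerivative, mul_assoc, Polynomial.coeff_add,
    show (2 : Polynomial ℝ) = Polynomial.C 2 from rfl, Polynomial.coeff_C_mul]
  cases k with
  | zero => simp
  | succ k =>
    rw [Polynomial.coeff_X_mul, Polynomial.coeff_derivative]
    push_cast
    ring

theorem derivative_X_mul_comp_sq (P : Polynomial ℝ) :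
    Polynomial.derivative (Polynomial.X * P.comp (Polynomial.X ^ 2)) =
      (oddDerivative P).comp (Polynomial.X ^ 2) := by
  simp [oddDerivative, Polynomial.derivative_comp, Polynomial.derivative_mul]
  ring

/-- Derivatives of real-rooted polynomials are real-rooted. -/
theorem im_eq_zero_of_aeval_derivative {P : Polynomial ℝ}
    (hP : ∀ z : ℂ, Polynomial.aeval z P = 0 → z.im = 0)
    (hd : Polynomial.derivative P ≠ 0) {z : ℂ}
    (hz : Polynomial.aeval z (Polynomial.derivative P) = 0) : z.im = 0 := by
  set Q : Polynomial ℂ := P.map (algebraMap ℝ ℂ) with hQ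
  have hdQ : Polynomial.derivative Q = (Polynomial.derivative P).map (algebraMap ℝ ℂ) := by
    rw [hQ, Polynomial.derivative_map]
  have hdQ0 : Polynomial.derivative Q ≠ 0 := by
    rw [hdQ]; exact (Polynomial.map_ne_zero_iff (algebraMap ℝ ℂ).injective).2 hd
  have hdeg : 0 < Q.degree := by
    by_contra h
    rw [Polynomial.eq_C_of_degree_le_zero (not_lt.1 h), Polynomial.derivative_C] at hdQ0
    exact hdQ0 rfl
  have hQ0 : Q ≠ 0 := by rintro h; rw [h] at hdeg; simp at hdeg
  have hmem : z ∈ (Polynomial.derivative Q).rootSet ℂ := by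
    rw [Polynomial.mem_rootSet]
    refine ⟨hdQ0, ?_⟩
    rw [hdQ, Polynomial.aeval_map_algebraMap]
    exact hz
  -- Gauss–Lucas puts critical points in the convex hull of the roots, and the real axis is convex.
  have hconv : Convex ℝ {z : ℂ | z.im = 0} := by
    intro x hx y hy s t _ _ _
    simp only [Set.mem_ofPred_eq] at *
    simp [hx, hy]
  refine convexHull_min ?_ hconv (Polynomial.rootSet_derivative_subset_convexHull_rootSet hdeg hmem)
  intro y hy
  rw [Polynomial.mem_rootSet, hQ, Polynomial.aeval_map_algebraMap] at hy
  exact hP y hy.2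

theorem im_eq_zero_of_sq {z : ℂ} (h1 : (z ^ 2).im = 0) (h2 : 0 ≤ (z ^ 2).re) : z.im = 0 := by
  rw [pow_two, Complex.mul_im] at h1
  rw [pow_two, Complex.mul_re] at h2
  have h : z.re * z.im = 0 := by linarith
  rcases mul_eq_zero.1 h with h | h
  · rw [h] at h2
    nlinarith
  · exact h

/-- Positive roots of P have real square roots, so X P(X²) is real-rooted, and its derivative
inherits this. -/
theorem oddDerivative_comp_sq_real_rooted {P : Polynomial ℝ} (h0 : P.coeff 0 = 1)
    (hP : ∀ w : ℂ, Polynomial.aeval w P = 0 → w.im = 0 ∧ 0 < w.re) {z : ℂ}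
    (hz : Polynomial.aeval z ((oddDerivative P).comp (Polynomial.X ^ 2)) = 0) : z.im = 0 := by
  rw [← derivative_X_mul_comp_sq] at hz
  refine im_eq_zero_of_aeval_derivative ?_ ?_ hz
  · intro y hy
    rw [map_mul, Polynomial.aeval_X, Polynomial.aeval_comp, map_pow, Polynomial.aeval_X] at hy
    rcases mul_eq_zero.1 hy with h | h
    · rw [h, Complex.zero_im]
    · obtain ⟨h1, h2⟩ := hP _ h
      exact im_eq_zero_of_sq h1 h2.le
  · rw [derivative_X_mul_comp_sq]
    intro h
    have := congrArg (Polynomial.eval 0) h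
    rw [Polynomial.eval_comp, Polynomial.eval_pow, Polynomial.eval_X, zero_pow two_ne_zero,
      ← Polynomial.coeff_zero_eq_eval_zero, coeff_oddDerivative, h0] at this
    simp at this

theorem oddDerivative_roots {P : Polynomial ℝ} (h0 : P.coeff 0 = 1)
    (hP : ∀ w : ℂ, Polynomial.aeval w P = 0 → w.im = 0 ∧ 0 < w.re) {w : ℂ}
    (hw : Polynomial.aeval w (oddDerivative P) = 0) : w.im = 0 ∧ 0 < w.re := by
  obtain ⟨z, rfl⟩ := IsAlgClosed.exists_pow_nat_eq w two_pos
  have him : z.im = 0 := by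
    refine oddDerivative_comp_sq_real_rooted h0 hP ?_
    rwa [Polynomial.aeval_comp, map_pow, Polynomial.aeval_X]
  have hz0 : z.re ≠ 0 := by
    intro h
    have hz : z = 0 := Complex.ext h him
    rw [hz, zero_pow two_ne_zero, ← Polynomial.coeff_zero_eq_aeval_zero', coeff_oddDerivative,
      h0] at hw
    simp at hw
  rw [pow_two, Complex.mul_im, Complex.mul_re, him]
  refine ⟨by ring, ?_⟩
  have := mul_self_pos.2 hz0
  linarith

/-! ### Even canonical products of genus zero -/

section evenProduct

variable {x : ℕ → ℝ}

theorem summable_norm_neg_mul (hs : Summable x) (hx : ∀ i, 0 ≤ x i) (w : ℂ) :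
    Summable fun m => ‖-((x m : ℂ) * w)‖ := by
  refine (hs.mul_right ‖w‖).congr fun m => ?_
  rw [norm_neg, norm_mul, Complex.norm_real, Real.norm_of_nonneg (hx m)]

theorem tprod_one_sub_eq (w : ℂ) :
    ∏' m, (1 - (x m : ℂ) * w) = ∏' m, (1 + -((x m : ℂ) * w)) := by
  simp_rw [sub_eq_add_neg]

theorem multipliable_one_sub (hs : Summable x) (hx : ∀ i, 0 ≤ x i) (w : ℂ) :
    Multipliable fun m => 1 - (x m : ℂ) * w := by
  simp_rw [sub_eq_add_neg]
  exact multipliable_one_add_of_summable (summable_norm_neg_mul hs hx w)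

theorem tprod_one_sub_ne_zero (hs : Summable x) (hx : ∀ i, 0 ≤ x i) {w : ℂ}
    (hw : ∀ m, 1 - (x m : ℂ) * w ≠ 0) : ∏' m, (1 - (x m : ℂ) * w) ≠ 0 := by
  rw [tprod_one_sub_eq]
  refine tprod_one_add_ne_zero_of_summable (fun i => ?_) (summable_norm_neg_mul hs hx w)
  rw [← sub_eq_add_neg]
  exact hw i

theorem tprod_one_sub_eq_zero_iff (hs : Summable x) (hx : ∀ i, 0 ≤ x i) {w : ℂ} :
    ∏' m, (1 - (x m : ℂ) * w) = 0 ↔ ∃ m, (x m : ℂ) * w = 1 := by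
  constructor
  · intro h
    by_contra! hne
    exact tprod_one_sub_ne_zero hs hx (fun m => sub_ne_zero.2 (hne m).symm) h
  · rintro ⟨m, hm⟩
    exact tprod_of_exists_eq_zero ⟨m, by rw [hm, sub_self]⟩

theorem multipliableLocallyUniformlyOn_one_sub (hs : Summable x) (hx : ∀ i, 0 ≤ x i) (R : ℝ) :
    MultipliableLocallyUniformlyOn (fun m (w : ℂ) => 1 - (x m : ℂ) * w) (Metric.ball 0 R) := by
  simp_rw [sub_eq_add_neg]
  refine Summable.multipliableLocallyUniformlyOn_nat_one_add Metric.isOpen_ball (hs.mul_right R)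
    (Eventually.of_forall fun m w hw => ?_) fun m => by fun_prop
  rw [norm_neg, norm_mul, Complex.norm_real, Real.norm_of_nonneg (hx m)]
  exact mul_le_mul_of_nonneg_left (by simpa using (Metric.mem_ball.1 hw).le) (hx m)

theorem differentiable_tprod_one_sub (hs : Summable x) (hx : ∀ i, 0 ≤ x i) :
    Differentiable ℂ fun w : ℂ => ∏' m, (1 - (x m : ℂ) * w) := by
  intro w
  have h := (multipliableLocallyUniformlyOn_one_sub hs hx (‖w‖ + 1)).hasProdLocallyUniformlyOn
  have hd : DifferentiableOn ℂ (fun w : ℂ => ∏' m, (1 - (x m : ℂ) * w))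
      (Metric.ball 0 (‖w‖ + 1)) := by
    refine TendstoLocallyUniformlyOn.differentiableOn
      (hasProdLocallyUniformlyOn_iff_tendstoLocallyUniformlyOn.1 h)
      (Eventually.of_forall fun s => ?_) Metric.isOpen_ball
    fun_prop
  exact (hd w (by simp)).differentiableAt (Metric.isOpen_ball.mem_nhds (by simp))

theorem differentiable_tprod_one_sub_sq (hs : Summable x) (hx : ∀ i, 0 ≤ x i) :
    Differentiable ℂ fun z : ℂ => ∏' m, (1 - (x m : ℂ) * z ^ 2) :=
  (differentiable_tprod_one_sub hs hx).comp (differentiable_id.pow 2)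

theorem finite_setOf_mul_eq_one (hs : Summable x) (t : ℝ) : {m | x m * t = 1}.Finite := by
  have h := (hs.mul_right t).tendsto_cofinite_zero
  have := h.eventually_lt_const one_pos
  rw [Filter.eventually_cofinite] at this
  exact this.subset fun m hm => by
    simp only [Set.mem_ofPred_eq] at hm ⊢
    rw [hm]; exact lt_irrefl _

/-- The order of vanishing of an even canonical product is the number of vanishing factors. -/
theorem analyticOrderNatAt_tprod_one_sub_sq (hs : Summable x) (hx : ∀ i, 0 ≤ x i) {γ : ℝ}
    (hγ : 0 < γ) :
    analyticOrderNatAt (fun z : ℂ => ∏' m, (1 - (x m : ℂ) * z ^ 2)) (γ : ℂ) =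
      Nat.card {m // x m * γ ^ 2 = 1} := by
  classical
  set s : Finset ℕ := (finite_setOf_mul_eq_one hs (γ ^ 2)).toFinset with hsdef
  have hmem : ∀ m, m ∈ s ↔ x m * γ ^ 2 = 1 := fun m => by simp [hsdef]
  have hcard : Nat.card {m // x m * γ ^ 2 = 1} = s.card :=
    Nat.subtype_card s hmem
  -- Setting the parameters of the vanishing factors to 0 splits off (1 - z²/γ²)^|s|, whose base has
  -- a simple zero at γ, and leaves a product that is nonzero there.
  set x' : ℕ → ℝ := fun m => if m ∈ s then 0 else x m with hx'
  have hx'0 : ∀ m, 0 ≤ x' m := fun m => by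
    simp only [hx']; split_ifs; exacts [le_rfl, hx m]
  have hx's : Summable x' := Summable.of_nonneg_of_le hx'0 (fun m => by
    simp only [hx']; split_ifs; exacts [hx m, le_rfl]) hs
  have hfac : (fun z : ℂ => ∏' m, (1 - (x m : ℂ) * z ^ 2)) =
      (fun z : ℂ => 1 - ((γ ^ 2)⁻¹ : ℝ) * z ^ 2) ^ s.card *
        fun z : ℂ => ∏' m, (1 - (x' m : ℂ) * z ^ 2) := by
    funext z
    have h1 : ∀ m, 1 - (x m : ℂ) * z ^ 2 =
        (if m ∈ s then 1 - (((γ ^ 2)⁻¹ : ℝ) : ℂ) * z ^ 2 else 1) * (1 - (x' m : ℂ) * z ^ 2) := by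
      intro m
      simp only [hx']
      split_ifs with h
      · rw [eq_inv_of_mul_eq_one_left ((hmem m).1 h)]; simp
      · simp
    have hm1 : Multipliable fun m => if m ∈ s then 1 - (((γ ^ 2)⁻¹ : ℝ) : ℂ) * z ^ 2 else 1 :=
      multipliable_of_ne_finset_one (s := s) fun m hm => if_neg hm
    rw [tprod_congr h1, hm1.tprod_mul (multipliable_one_sub hx's hx'0 _),
      tprod_eq_prod (s := s) fun m hm => if_neg hm, Finset.prod_ite_mem, Finset.inter_self,
      Finset.prod_const]
    rfl
  have hA : AnalyticAt ℂ (fun z : ℂ => 1 - (((γ ^ 2)⁻¹ : ℝ) : ℂ) * z ^ 2) (γ : ℂ) := by fun_prop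
  have hB : AnalyticAt ℂ (fun z : ℂ => ∏' m, (1 - (x' m : ℂ) * z ^ 2)) (γ : ℂ) :=
    (differentiable_tprod_one_sub_sq hx's hx'0).analyticAt _
  have hγ' : (γ : ℂ) ≠ 0 := by exact_mod_cast hγ.ne'
  have hordA : analyticOrderAt (fun z : ℂ => 1 - (((γ ^ 2)⁻¹ : ℝ) : ℂ) * z ^ 2) (γ : ℂ) = 1 := by
    refine hA.analyticOrderAt_eq_one_of_zero_deriv_ne_zero ?_ ?_
    · push_cast
      field_simp
      ring
    · have : deriv (fun z : ℂ => 1 - (((γ ^ 2)⁻¹ : ℝ) : ℂ) * z ^ 2) (γ : ℂ) =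
          -((((γ ^ 2)⁻¹ : ℝ) : ℂ) * (2 * γ)) := by
        simp
      rw [this]
      push_cast
      norm_num
      exact hγ.ne'
  have hordB : analyticOrderAt (fun z : ℂ => ∏' m, (1 - (x' m : ℂ) * z ^ 2)) (γ : ℂ) = 0 := by
    rw [hB.analyticOrderAt_eq_zero]
    refine tprod_one_sub_ne_zero hx's hx'0 fun m => ?_
    simp only [hx']
    split_ifs with h
    · simp
    · rw [hmem] at h
      rw [sub_ne_zero]
      exact_mod_cast Ne.symm h
  rw [hcard, analyticOrderNatAt, hfac, analyticOrderAt_mul (hA.pow _) hB, analyticOrderAt_pow hA,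
    hordA, hordB]
  simp

/-- Send each nonzero x m to the zero 1/√(x m) and sum over the fibres of this map: the fibre over γ
has as many elements as the multiplicity of γ. Vanishing parameters belong to no zero and contribute
nothing since k ≠ 0. -/
theorem hasEulerRayleighSum_tprod (hs : Summable x) (hx : ∀ i, 0 ≤ x i) {k : ℕ} (hk : k ≠ 0)
    {S : ℝ} (hS : HasSum (fun m => x m ^ k) S) :
    HasEulerRayleighSum (fun z : ℂ => ∏' m, (1 - (x m : ℂ) * z ^ 2)) k S := by
  set f : ℂ → ℂ := fun z : ℂ => ∏' m, (1 - (x m : ℂ) * z ^ 2) with hf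
  have hroot : ∀ γ : ℝ, f γ = 0 ↔ ∃ m, x m * γ ^ 2 = 1 := by
    intro γ
    rw [hf]
    simp only
    rw [tprod_one_sub_eq_zero_iff hs hx]
    norm_cast
  have hpos : ∀ a : {m // x m ≠ 0}, 0 < x a := fun a => lt_of_le_of_ne (hx a) a.2.symm
  have hsq : ∀ a : {m // x m ≠ 0}, x a * (√(x a))⁻¹ ^ 2 = 1 := fun a => by
    rw [inv_pow, Real.sq_sqrt (hx a), mul_inv_cancel₀ a.2]
  set φ : {m // x m ≠ 0} → {γ : ℝ // 0 < γ ∧ f γ = 0} := fun a =>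
    ⟨(√(x a))⁻¹, inv_pos.2 (Real.sqrt_pos.2 (hpos a)), (hroot _).2 ⟨a, hsq a⟩⟩ with hφ
  have hφiff : ∀ (a : {m // x m ≠ 0}) (γ : {γ : ℝ // 0 < γ ∧ f γ = 0}),
      φ a = γ ↔ x a * (γ : ℝ) ^ 2 = 1 := by
    intro a γ
    constructor
    · rintro rfl
      exact hsq a
    · intro h
      have h2 : (√(x a))⁻¹ ^ 2 = (γ : ℝ) ^ 2 := mul_left_cancel₀ a.2 ((hsq a).trans h.symm)
      exact Subtype.ext ((pow_left_inj₀ (φ a).2.1.le γ.2.1.le two_ne_zero).1 h2)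
  have h1 : HasSum (fun a : {m // x m ≠ 0} => x a ^ k) S := by
    refine (hasSum_subtype_iff_of_support_subset (s := {m | x m ≠ 0})
      (f := fun m => x m ^ k) ?_).2 hS
    intro m hm h
    exact hm (by simp only [h]; exact zero_pow hk)
  rw [← (Equiv.sigmaFiberEquiv φ).hasSum_iff] at h1
  refine h1.sigma fun γ => ?_
  have hcard : Nat.card {a // φ a = γ} = Nat.card {m // x m * (γ : ℝ) ^ 2 = 1} :=
    Nat.card_congr
      { toFun := fun a => ⟨a.1.1, (hφiff _ _).1 a.2⟩
        invFun := fun m => ⟨⟨m.1, fun h => by have := m.2; rw [h, zero_mul] at this; simp at this⟩,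
          (hφiff _ _).2 m.2⟩
        left_inv := fun _ => rfl
        right_inv := fun _ => rfl }
  have hfin : Finite {m // x m * (γ : ℝ) ^ 2 = 1} := finite_setOf_mul_eq_one hs _
  have hne : Nat.card {m // x m * (γ : ℝ) ^ 2 = 1} ≠ 0 := by
    obtain ⟨m, hm⟩ := (hroot γ).1 γ.2.2
    have : Nonempty {m // x m * (γ : ℝ) ^ 2 = 1} := ⟨⟨m, hm⟩⟩
    exact Nat.card_pos.ne'
  have hfin' : Finite {a // φ a = γ} := (Nat.card_ne_zero.1 (hcard ▸ hne)).2
  have := Fintype.ofFinite {a // φ a = γ}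
  have hval : ∀ a : {a // φ a = γ}, x a.1 ^ k = ((γ : ℝ) ^ (2 * k))⁻¹ := by
    intro a
    rw [eq_inv_of_mul_eq_one_left ((hφiff _ _).1 a.2), inv_pow, pow_mul]
  have h2 := hasSum_fintype fun a : {a // φ a = γ} => x a.1 ^ k
  rw [Finset.sum_congr rfl fun a _ => hval a, Finset.sum_const, Finset.card_univ,
    ← Nat.card_eq_fintype_card, hcard, ← analyticOrderNatAt_tprod_one_sub_sq hs hx γ.2.1,
    nsmul_eq_mul] at h2
  exact h2

end evenProduct

/-! ### The power series of the normalized Hahn-Exton function -/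

theorem qPochInf_ne_zero {a q : ℝ} (ha0 : 0 < a) (ha : a < 1) (hq0 : 0 < q) (hq1 : q < 1) :
    qPochInf a q ≠ 0 := by
  have h : qPochInf a q = ∏' k : ℕ, (1 + -(a * q ^ k)) := by
    simp_rw [qPochInf, sub_eq_add_neg]
  rw [h]
  refine tprod_one_add_ne_zero_of_summable (fun i => ?_) ?_
  · rw [← sub_eq_add_neg]
    exact (one_sub_mul_pow_pos ha hq0 hq1 i).ne'
  · refine ((summable_geometric_of_lt_one hq0.le hq1).mul_left a).congr fun k => ?_
    rw [norm_neg, Real.norm_of_nonneg (by positivity)]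

theorem rpow_add_one_mem {ν q : ℝ} (hν : -1 < ν) (hq0 : 0 < q) (hq1 : q < 1) :
    0 < q ^ (ν + 1) ∧ q ^ (ν + 1) < 1 :=
  ⟨Real.rpow_pos_of_pos hq0 _, Real.rpow_lt_one hq0.le hq1 (by linarith)⟩

theorem cNu_ne_zero {ν q : ℝ} (hν : -1 < ν) (hq0 : 0 < q) (hq1 : q < 1) : cNu ν q ≠ 0 := by
  obtain ⟨h1, h2⟩ := rpow_add_one_mem hν hq0 hq1
  exact div_ne_zero (qPochInf_ne_zero hq0 hq1 hq0 hq1) (qPochInf_ne_zero h1 h2 hq0 hq1)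

theorem cpow_mul_cpow_odd {z : ℂ} (hz : z ≠ 0) (ν : ℝ) (n : ℕ) :
    z ^ (((1 - ν : ℝ)) : ℂ) * z ^ (((2 * n + ν : ℝ)) : ℂ) = z * (z ^ 2) ^ n := by
  rw [← Complex.cpow_add _ _ hz]
  have : (((1 - ν : ℝ)) : ℂ) + (((2 * n + ν : ℝ)) : ℂ) = ((2 * n + 1 : ℕ) : ℂ) := by
    push_cast; ring
  rw [this, Complex.cpow_natCast, pow_succ, pow_mul, mul_comm]

theorem gThree_eq_tsum {ν q : ℝ} (hν : -1 < ν) (hq0 : 0 < q) (hq1 : q < 1) (z : ℂ) :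
    gThree ν q z = z * ∑' n, ((besselCoeff (q ^ (ν + 1)) q n : ℝ) : ℂ) * (z ^ 2) ^ n := by
  obtain ⟨h1, h2⟩ := rpow_add_one_mem hν hq0 hq1
  by_cases hz : z = 0
  · subst hz
    rw [zero_mul, gThree]
    -- The outer power 0^(1-ν) is 0 unless ν = 1, when it is 1; in that case every term of the
    -- series contains 0^(2n+1) = 0.
    by_cases hν1 : ν = 1
    · subst hν1
      have : ∀ n : ℕ, (0 : ℂ) ^ (((2 * n + 1 : ℝ)) : ℂ) = 0 := fun n =>
        Complex.zero_cpow (by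
          have : (2 * n + 1 : ℝ) ≠ 0 := by positivity
          exact_mod_cast this)
      simp only [hahnExtonJ, this, mul_zero, tsum_zero]
    · rw [Complex.zero_cpow (by
        have : (1 - ν : ℝ) ≠ 0 := sub_ne_zero.2 (Ne.symm hν1)
        exact_mod_cast this)]
      simp
  · have hc : (cNu ν q : ℂ) * ((qPochInf (q ^ (ν + 1)) q / qPochInf q q : ℝ) : ℂ) = 1 := by
      rw [← Complex.ofReal_mul, cNu, div_mul_div_cancel₀ (qPochInf_ne_zero h1 h2 hq0 hq1),
        div_self (qPochInf_ne_zero hq0 hq1 hq0 hq1), Complex.ofReal_one]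
    rw [gThree, hahnExtonJ]
    calc _ = ((cNu ν q : ℂ) * ((qPochInf (q ^ (ν + 1)) q / qPochInf q q : ℝ) : ℂ)) *
          (z ^ (((1 - ν : ℝ)) : ℂ) * ∑' n : ℕ, ((besselCoeff (q ^ (ν + 1)) q n : ℝ) : ℂ) *
            z ^ (((2 * n + ν : ℝ)) : ℂ)) := by
          simp only [besselCoeff]; ring
      _ = _ := by
        rw [hc, one_mul, ← tsum_mul_left, ← tsum_mul_left]
        refine tsum_congr fun n => ?_
        rw [mul_left_comm, cpow_mul_cpow_odd hz, mul_left_comm]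

/-- For nonzero `z` the Hahn-Exton function is recovered from its normalization. -/
theorem hahnExtonJ_eq {ν q : ℝ} (hν : -1 < ν) (hq0 : 0 < q) (hq1 : q < 1) {z : ℂ} (hz : z ≠ 0) :
    hahnExtonJ ν q z = (cNu ν q : ℂ)⁻¹ * (z ^ (((ν - 1 : ℝ)) : ℂ) * gThree ν q z) := by
  have hc : (cNu ν q : ℂ) ≠ 0 := by exact_mod_cast cNu_ne_zero hν hq0 hq1
  have h : z ^ (((ν - 1 : ℝ)) : ℂ) * z ^ (((1 - ν : ℝ)) : ℂ) = 1 := by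
    rw [← Complex.cpow_add _ _ hz, ← Complex.ofReal_add]
    simp
  rw [gThree]
  field_simp
  rw [mul_assoc, h, mul_one]

theorem sign_besselCoeff_pos {b q : ℝ} (hb : b < 1) (hq0 : 0 < q) (hq1 : q < 1) (n : ℕ) :
    0 < (-1) ^ n * besselCoeff b q n := by
  have h1 := qPoch_pos hq1 hq0 hq1 n
  have h2 := qPoch_pos hb hq0 hq1 n
  have e : (-1) ^ n * besselCoeff b q n = q ^ (n * (n + 1) / 2) / (qPoch q q n * qPoch b q n) := by
    rw [besselCoeff, ← mul_div_assoc, ← mul_assoc, ← mul_pow]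
    norm_num
  rw [e]
  positivity

/-- Bernoulli's inequality 2k + 1 ≤ 3^k absorbs the factor from differentiation into the geometric
base, so the derivative has a majorant of the same Gaussian shape. -/
theorem abs_mul_two_mul_add_one_le {d B c : ℝ} {k : ℕ} (h : |c| ≤ d ^ k * B) :
    |(2 * k + 1) * c| ≤ (3 * d) ^ k * B := by
  have h3 : (2 * k + 1 : ℝ) ≤ 3 ^ k := by
    have := one_add_mul_le_pow (a := (2 : ℝ)) (by norm_num) k
    norm_num at this
    linarith
  rw [abs_mul, abs_of_nonneg (by positivity : (0 : ℝ) ≤ 2 * k + 1), mul_pow, mul_assoc]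
  exact mul_le_mul h3 h (abs_nonneg _) (by positivity)

/-- Local uniform convergence of even power series with dominated coefficients. -/
theorem tendstoLocallyUniformly_tsum_coeff {A : ℕ → ℕ → ℝ} {a : ℕ → ℝ} {D ρ : ℝ} (hD : 0 ≤ D)
    (hρ0 : 0 < ρ) (hρ1 : ρ < 1) (hb : ∀ N n, |A N n| ≤ D ^ n * ρ ^ (n * (n + 1)))
    (ha : ∀ n, Tendsto (fun N => A N n) atTop (𝓝 (a n))) :
    TendstoLocallyUniformly (fun N (z : ℂ) => ∑' n, ((A N n : ℝ) : ℂ) * (z ^ 2) ^ n)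
      (fun z => ∑' n, ((a n : ℝ) : ℂ) * (z ^ 2) ^ n) atTop := by
  rw [Metric.tendstoLocallyUniformly_iff]
  intro ε hε z₀
  set R : ℝ := (‖z₀‖ + 1) ^ 2 with hR
  have hR0 : 0 ≤ R := by positivity
  have hba := abs_coeff_limit_le hb ha
  have hsum : ∀ c : ℕ → ℝ, (∀ n, |c n| ≤ D ^ n * ρ ^ (n * (n + 1))) →
      Summable fun n => |c n| * R ^ n := fun c hc =>
    Summable.of_nonneg_of_le (fun n => by positivity)
      (fun n => mul_le_mul_of_nonneg_right (hc n) (by positivity))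
      (summable_pow_mul_pow_mul_succ hD hρ0 hρ1 hR0)
  have hlim : Tendsto (fun N => ∑' n, |a n - A N n| * R ^ n) atTop (𝓝 0) := by
    have h := tendsto_tsum_of_dominated_convergence (𝓕 := atTop)
      (f := fun N n => |a n - A N n| * R ^ n) (g := fun _ => (0 : ℝ))
      (bound := fun n => 2 * (D ^ n * ρ ^ (n * (n + 1)) * R ^ n))
      ((summable_pow_mul_pow_mul_succ hD hρ0 hρ1 hR0).mul_left 2)
      (fun n => by
        have := ((ha n).const_sub (a n)).abs.mul_const (R ^ n)
        simpa using this)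
      (Eventually.of_forall fun N n => by
        rw [Real.norm_of_nonneg (by positivity), ← mul_assoc]
        refine mul_le_mul_of_nonneg_right ?_ (by positivity)
        refine (abs_sub _ _).trans ?_
        linarith [hba n, hb N n])
    simpa using h
  refine ⟨Metric.ball z₀ 1, Metric.ball_mem_nhds _ one_pos, ?_⟩
  filter_upwards [hlim.eventually_lt_const hε] with N hN z hz
  have hzR : ‖z ^ 2‖ ≤ R := by
    rw [norm_pow]
    refine pow_le_pow_left₀ (norm_nonneg _) ?_ 2
    have h1 : ‖z - z₀‖ < 1 := mem_ball_iff_norm.1 hz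
    have h2 := norm_add_le (z - z₀) z₀
    rw [sub_add_cancel] at h2
    linarith
  have hterm : ∀ c : ℝ, ∀ n : ℕ, ‖((c : ℝ) : ℂ) * (z ^ 2) ^ n‖ ≤ |c| * R ^ n := fun c n => by
    rw [norm_mul, Complex.norm_real, norm_pow, Real.norm_eq_abs]
    exact mul_le_mul_of_nonneg_left (pow_le_pow_left₀ (norm_nonneg _) hzR n) (abs_nonneg _)
  have hsz : ∀ c : ℕ → ℝ, (∀ n, |c n| ≤ D ^ n * ρ ^ (n * (n + 1))) →
      Summable fun n => ((c n : ℝ) : ℂ) * (z ^ 2) ^ n := fun c hc =>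
    Summable.of_norm_bounded (hsum c hc) fun n => hterm (c n) n
  rw [dist_eq_norm, ← (hsz a hba).tsum_sub (hsz (A N) (hb N))]
  refine lt_of_le_of_lt ?_ hN
  have hsd : Summable fun n => |a n - A N n| * R ^ n :=
    Summable.of_nonneg_of_le (fun n => by positivity) (fun n => by
      rw [← add_mul]
      exact mul_le_mul_of_nonneg_right (abs_sub _ _) (by positivity))
      ((hsum a hba).add (hsum (A N) (hb N)))
  refine tsum_of_norm_bounded hsd.hasSum fun n => ?_
  rw [← sub_mul, ← Complex.ofReal_sub]
  exact hterm _ n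

/-- Termwise differentiation of an odd power series with coefficients of Gaussian decay. -/
theorem hasDerivAt_mul_tsum_sq {a : ℕ → ℝ} {D ρ : ℝ} (hD : 0 ≤ D) (hρ0 : 0 < ρ) (hρ1 : ρ < 1)
    (hb : ∀ n, |a n| ≤ D ^ n * ρ ^ (n * (n + 1))) (z : ℂ) :
    HasDerivAt (fun z : ℂ => z * ∑' n, ((a n : ℝ) : ℂ) * (z ^ 2) ^ n)
      (∑' n : ℕ, (((2 * n + 1) * a n : ℝ) : ℂ) * (z ^ 2) ^ n) z := by
  set R : ℝ := ‖z‖ + 1 with hR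
  have hR0 : 0 < R := by positivity
  have hzR : z ∈ Metric.ball (0 : ℂ) R := by simp [hR]
  have hu : Summable fun n : ℕ => R * (D ^ n * ρ ^ (n * (n + 1)) * (R ^ 2) ^ n) :=
    (summable_pow_mul_pow_mul_succ hD hρ0 hρ1 (by positivity)).mul_left R
  have hdiff : ∀ n : ℕ, DifferentiableOn ℂ (fun z : ℂ => z * (((a n : ℝ) : ℂ) * (z ^ 2) ^ n))
      (Metric.ball 0 R) := fun n => by fun_prop
  have hbound : ∀ n : ℕ, ∀ w : ℂ, w ∈ Metric.ball (0 : ℂ) R →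
      ‖w * (((a n : ℝ) : ℂ) * (w ^ 2) ^ n)‖ ≤ R * (D ^ n * ρ ^ (n * (n + 1)) * (R ^ 2) ^ n) := by
    intro n w hw
    have hw' : ‖w‖ ≤ R := by simpa using (Metric.mem_ball.1 hw).le
    rw [norm_mul, norm_mul, Complex.norm_real, norm_pow, norm_pow, Real.norm_eq_abs]
    have := hb n
    gcongr
  have h1 := Complex.hasSum_deriv_of_summable_norm hu hdiff Metric.isOpen_ball hbound hzR
  have h2 := Complex.differentiableOn_tsum_of_summable_norm hu hdiff Metric.isOpen_ball hbound
  have h3 : HasDerivAt (fun w : ℂ => ∑' n, w * (((a n : ℝ) : ℂ) * (w ^ 2) ^ n))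
      (∑' n : ℕ, (((2 * n + 1) * a n : ℝ) : ℂ) * (z ^ 2) ^ n) z := by
    have e : ∑' n : ℕ, (((2 * n + 1) * a n : ℝ) : ℂ) * (z ^ 2) ^ n =
        deriv (fun w : ℂ => ∑' n, w * (((a n : ℝ) : ℂ) * (w ^ 2) ^ n)) z := by
      rw [← h1.tsum_eq]
      refine tsum_congr fun n => ?_
      have : HasDerivAt (fun z : ℂ => z * (((a n : ℝ) : ℂ) * (z ^ 2) ^ n))
          ((((2 * n + 1) * a n : ℝ) : ℂ) * (z ^ 2) ^ n) z := by
        have h := (hasDerivAt_pow (2 * n + 1) z).const_mul ((a n : ℝ) : ℂ)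
        have e1 : (fun z : ℂ => z * (((a n : ℝ) : ℂ) * (z ^ 2) ^ n)) =
            fun z : ℂ => ((a n : ℝ) : ℂ) * z ^ (2 * n + 1) := by
          funext z; ring
        rw [e1]
        refine h.congr_deriv ?_
        rw [Nat.add_sub_cancel]
        push_cast
        ring
      exact this.deriv.symm
    rw [e]
    exact (h2.differentiableAt (Metric.isOpen_ball.mem_nhds hzR)).hasDerivAt
  simpa only [tsum_mul_left] using h3

/-- Infinitely many factors are nontrivial if the power series has strictly alternating
coefficients. -/
theorem exists_pos_factor_of_alternating {a : ℕ → ℝ} {x : ℕ → ℝ} (hx : ∀ i, 0 ≤ x i)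
    (hanti : Antitone x) (ha : ∀ n, 0 < (-1) ^ n * a n)
    (hs : ∀ w : ℂ, Summable fun n => ((a n : ℝ) : ℂ) * w ^ n)
    (h : ∀ w : ℂ, ∑' n, ((a n : ℝ) : ℂ) * w ^ n = ∏' m, (1 - (x m : ℂ) * w)) (M : ℕ) :
    0 < x M := by
  by_contra hM
  have hzero : ∀ m, M ≤ m → x m = 0 := fun m hm =>
    le_antisymm ((hanti hm).trans (not_lt.1 hM)) (hx m)
  set c := (-1) ^ (M + 1) * a (M + 1) with hc
  have hc0 : 0 < c := ha _
  -- If x vanishes from M on, then at w = -t the product grows at most like t^M, while the series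
  -- has only positive terms, among them c t^(M+1).
  have key : ∀ t : ℝ, 1 ≤ t → c * t ≤ (1 + x 0) ^ M := by
    intro t ht
    have ht0 : 0 < t := by linarith
    have hcast : ∀ n, ((a n : ℝ) : ℂ) * ((-t : ℝ) : ℂ) ^ n = (((-1) ^ n * a n * t ^ n : ℝ) : ℂ) := by
      intro n
      rw [neg_eq_neg_one_mul]
      push_cast
      rw [mul_pow]
      ring
    have hsr : Summable fun n => (-1) ^ n * a n * t ^ n := by
      have := hs ((-t : ℝ) : ℂ)
      simp_rw [hcast] at this
      exact Complex.summable_ofReal.1 this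
    have h1 : ∑' n, (-1) ^ n * a n * t ^ n = ∏ m ∈ Finset.range M, (1 + x m * t) := by
      have h2 := h ((-t : ℝ) : ℂ)
      simp_rw [hcast] at h2
      rw [← Complex.ofReal_tsum, tprod_eq_prod (s := Finset.range M) (fun m hm => by
        rw [hzero m (by simpa using hm)]; simp)] at h2
      apply Complex.ofReal_injective
      rw [h2]
      push_cast
      refine Finset.prod_congr rfl fun m _ => by ring
    have h2 : c * t ^ (M + 1) ≤ ∑' n, (-1) ^ n * a n * t ^ n :=
      hsr.le_tsum (M + 1) fun n _ => mul_nonneg (ha n).le (by positivity)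
    have h3 : ∏ m ∈ Finset.range M, (1 + x m * t) ≤ ((1 + x 0) * t) ^ M := by
      have := Finset.prod_le_prod (s := Finset.range M) (f := fun m => 1 + x m * t)
        (g := fun _ => (1 + x 0) * t) (fun m _ => by have := hx m; positivity) (fun m _ => by
          have := mul_le_mul_of_nonneg_right (hanti (Nat.zero_le m)) ht0.le
          linarith)
      simpa using this
    rw [h1] at h2
    have h4 := h2.trans h3
    rw [mul_pow, pow_succ, mul_comm (t ^ M) t, ← mul_assoc] at h4
    exact le_of_mul_le_mul_right h4 (by positivity)
  have hK : 1 ≤ (1 + x 0) ^ M := one_le_pow₀ (by linarith [hx 0])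
  have hpos : 0 < (1 + x 0) ^ M / c := by positivity
  have := key ((1 + x 0) ^ M / c + 1) (by linarith)
  rw [mul_add, mul_div_cancel₀ _ hc0.ne'] at this
  linarith

/-! ### The radius of starlikeness of an odd canonical product -/

section starlike

variable {x y : ℕ → ℝ}

theorem ofReal_tprod_one_sub (hs : Summable x) (hx : ∀ i, 0 ≤ x i) (t : ℝ) :
    ∏' m, (1 - (x m : ℂ) * (t : ℂ) ^ 2) = ((∏' m, (1 - x m * t ^ 2) : ℝ) : ℂ) := by
  have hm : Multipliable fun m => 1 - x m * t ^ 2 := by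
    simp_rw [sub_eq_add_neg]
    exact multipliable_one_add_of_summable ((hs.mul_right (t ^ 2)).congr fun m => by
      rw [norm_neg, Real.norm_of_nonneg (mul_nonneg (hx m) (sq_nonneg t))])
  have := hm.map_tprod (Complex.ofRealHom) Complex.continuous_ofReal
  simp only [Complex.ofRealHom_eq_coe] at this
  rw [this]
  refine tprod_congr fun m => ?_
  push_cast
  rfl

theorem tprod_one_sub_pos (hs : Summable x) {t : ℝ} (ht : ∀ m, x m * t ^ 2 < 1) :
    0 < ∏' m, (1 - x m * t ^ 2) := by
  rw [← Real.rexp_tsum_eq_tprod (fun m => sub_pos.2 (ht m))]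
  · exact Real.exp_pos _
  · simp_rw [sub_eq_add_neg]
    exact Real.summable_log_one_add_of_summable (hs.mul_right (t ^ 2)).neg

/-- Since |1 - a w| ≥ 1 - a|w|, the worst case on a circle is the positive axis; this reduces
starlikeness to real arguments. -/
theorem norm_div_one_sub_le {a : ℝ} (ha : 0 ≤ a) {w : ℂ} (h : a * ‖w‖ < 1) :
    ‖(a : ℂ) * w / (1 - (a : ℂ) * w)‖ ≤ a * ‖w‖ / (1 - a * ‖w‖) := by
  have hn : ‖(a : ℂ) * w‖ = a * ‖w‖ := by
    rw [norm_mul, Complex.norm_real, Real.norm_of_nonneg ha]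
  rw [norm_div, hn]
  have h1 : 1 - a * ‖w‖ ≤ ‖1 - (a : ℂ) * w‖ := by
    have := norm_sub_norm_le (1 : ℂ) ((a : ℂ) * w)
    rwa [norm_one, hn] at this
  exact div_le_div_of_nonneg_left (mul_nonneg ha (norm_nonneg _)) (by linarith) h1

theorem summable_div_one_sub (hs : Summable y) (hy : ∀ i, 0 ≤ y i) (hanti : Antitone y) {r : ℝ}
    (hr0 : 0 ≤ r) (hr : y 0 * r < 1) : Summable fun m => y m * r / (1 - y m * r) := by
  have hle : ∀ m, y m * r ≤ y 0 * r := fun m =>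
    mul_le_mul_of_nonneg_right (hanti (Nat.zero_le m)) hr0
  refine Summable.of_nonneg_of_le (fun m => div_nonneg (mul_nonneg (hy m) hr0)
    (by linarith [hle m])) (fun m => ?_) ((hs.mul_right r).mul_right (1 - y 0 * r)⁻¹)
  rw [← div_eq_mul_inv]
  exact div_le_div_of_nonneg_left (mul_nonneg (hy m) hr0) (by linarith) (by linarith [hle m])

/-- The logarithmic derivative of an odd canonical product. -/
theorem mul_deriv_div_eq (hs : Summable y) (hy : ∀ i, 0 ≤ y i) (hanti : Antitone y) {z : ℂ}
    (hz : z ≠ 0) (hr : y 0 * ‖z‖ ^ 2 < 1) :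
    z * deriv (fun z : ℂ => z * ∏' m, (1 - (y m : ℂ) * z ^ 2)) z /
        (z * ∏' m, (1 - (y m : ℂ) * z ^ 2)) =
      1 - 2 * ∑' m, (y m : ℂ) * z ^ 2 / (1 - (y m : ℂ) * z ^ 2) := by
  set Φ : ℂ → ℂ := fun w => ∏' m, (1 - (y m : ℂ) * w) with hΦ
  have hd : Differentiable ℂ Φ := differentiable_tprod_one_sub hs hy
  have hlt : ∀ m, y m * ‖z ^ 2‖ < 1 := fun m => by
    rw [norm_pow]
    exact lt_of_le_of_lt (mul_le_mul_of_nonneg_right (hanti (Nat.zero_le m)) (by positivity)) hr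
  have hne : ∀ m, 1 - (y m : ℂ) * z ^ 2 ≠ 0 := fun m h => by
    have h1 : ‖(y m : ℂ) * z ^ 2‖ = 1 := by rw [← sub_eq_zero.1 h, norm_one]
    rw [norm_mul, Complex.norm_real, Real.norm_of_nonneg (hy m)] at h1
    exact (hlt m).ne h1
  have hΦ0 : Φ (z ^ 2) ≠ 0 := tprod_one_sub_ne_zero hs hy hne
  have hsum : Summable fun m => (y m : ℂ) * z ^ 2 / (1 - (y m : ℂ) * z ^ 2) :=
    Summable.of_norm_bounded (summable_div_one_sub hs hy hanti (norm_nonneg (z ^ 2)) (hlt 0))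
      fun m => norm_div_one_sub_le (hy m) (hlt m)
  have hld : ∀ m, logDeriv (fun w : ℂ => 1 - (y m : ℂ) * w) (z ^ 2) =
      -(z ^ 2)⁻¹ * ((y m : ℂ) * z ^ 2 / (1 - (y m : ℂ) * z ^ 2)) := fun m => by
    have : deriv (fun w : ℂ => 1 - (y m : ℂ) * w) (z ^ 2) = -(y m : ℂ) := by simp
    rw [logDeriv_apply, this]
    have := hne m
    field_simp
  have hlog : logDeriv Φ (z ^ 2) =
      -(z ^ 2)⁻¹ * ∑' m, (y m : ℂ) * z ^ 2 / (1 - (y m : ℂ) * z ^ 2) := by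
    rw [← tsum_mul_left, ← tsum_congr hld]
    refine logDeriv_tprod_eq_tsum (s := Metric.ball 0 (‖z ^ 2‖ + 1)) Metric.isOpen_ball (by simp)
      hne (fun m => by fun_prop) ?_ (multipliableLocallyUniformlyOn_one_sub hs hy _) hΦ0
    simp_rw [hld]
    exact hsum.mul_left _
  have hderiv : deriv (fun z : ℂ => z * Φ (z ^ 2)) z = Φ (z ^ 2) + z * (deriv Φ (z ^ 2) * (2 * z)) := by
    have h1 : HasDerivAt (fun z : ℂ => Φ (z ^ 2)) (deriv Φ (z ^ 2) * (2 * z)) z := by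
      have h2 : HasDerivAt (fun z : ℂ => z ^ 2) (2 * z) z := by simpa using hasDerivAt_pow 2 z
      exact (hd (z ^ 2)).hasDerivAt.comp z h2
    have h3 : HasDerivAt (fun z : ℂ => z * Φ (z ^ 2))
        (1 * Φ (z ^ 2) + z * (deriv Φ (z ^ 2) * (2 * z))) z := (hasDerivAt_id z).mul h1
    rw [h3.deriv, one_mul]
  change z * deriv (fun z : ℂ => z * Φ (z ^ 2)) z / (z * Φ (z ^ 2)) = _
  rw [hderiv, mul_div_mul_left _ _ hz]
  have e : (Φ (z ^ 2) + z * (deriv Φ (z ^ 2) * (2 * z))) / Φ (z ^ 2) =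
      1 + 2 * z ^ 2 * logDeriv Φ (z ^ 2) := by
    rw [logDeriv_apply]
    field_simp
  rw [e, hlog]
  field_simp
  ring

/-- The radius of starlikeness of an odd canonical product is the smallest zero of its derivative. -/
theorem starlikenessRadius_eq (hs : Summable y) (hy : ∀ i, 0 ≤ y i) (hanti : Antitone y)
    (hs' : Summable x) (hx : ∀ i, 0 ≤ x i) (hanti' : Antitone x) (hx0 : 0 < x 0) {g : ℂ → ℂ}
    (hg : ∀ z, g z = z * ∏' m, (1 - (y m : ℂ) * z ^ 2))
    (hg' : ∀ z, HasDerivAt g (∏' m, (1 - (x m : ℂ) * z ^ 2)) z) :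
    starlikenessRadius g = (√(x 0))⁻¹ := by
  set γ := (√(x 0))⁻¹ with hγ
  have hγ0 : 0 < γ := inv_pos.2 (Real.sqrt_pos.2 hx0)
  have hγ2 : x 0 * γ ^ 2 = 1 := by
    rw [hγ, inv_pow, Real.sq_sqrt (hx 0), mul_inv_cancel₀ hx0.ne']
  have hlt : ∀ t, 0 ≤ t → t < γ → ∀ m, x m * t ^ 2 < 1 := fun t ht0 ht m => by
    have h1 : t ^ 2 < γ ^ 2 := pow_lt_pow_left₀ ht ht0 two_ne_zero
    have h2 := mul_le_mul_of_nonneg_right (hanti' (Nat.zero_le m)) (sq_nonneg t)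
    have h3 := mul_lt_mul_of_pos_left h1 hx0
    linarith
  set u : ℝ → ℝ := fun t => (g t).re with hu
  have hgu : ∀ t : ℝ, g t = ((t * ∏' m, (1 - y m * t ^ 2) : ℝ) : ℂ) := fun t => by
    rw [hg, ofReal_tprod_one_sub hs hy, Complex.ofReal_mul]
  have hgr : ∀ t : ℝ, g t = (u t : ℂ) := fun t => by
    simp only [hu, hgu, Complex.ofReal_re]
  have hud : ∀ t : ℝ, HasDerivAt u (∏' m, (1 - x m * t ^ 2)) t := fun t => by
    have := (hg' t).real_of_complex
    rwa [ofReal_tprod_one_sub hs' hx, Complex.ofReal_re] at this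
  have hmono : StrictMonoOn u (Set.Icc 0 γ) := by
    refine strictMonoOn_of_deriv_pos (convex_Icc _ _)
      (fun t _ => (hud t).continuousAt.continuousWithinAt) fun t ht => ?_
    rw [interior_Icc] at ht
    rw [(hud t).deriv]
    exact tprod_one_sub_pos hs' (hlt t ht.1.le ht.2)
  have hu0 : u 0 = 0 := by simp [hu, hg]
  have hupos : ∀ t, 0 < t → t ≤ γ → 0 < u t := fun t ht0 ht => by
    rw [← hu0]
    exact hmono ⟨le_rfl, hγ0.le⟩ ⟨ht0.le, ht⟩ ht0
  -- The first positive zero of g lies beyond γ: g increases strictly from g(0) = 0 on [0, γ], so it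
  -- has no zero in (0, γ].
  have hyγ : y 0 * γ ^ 2 < 1 := by
    by_contra hcon
    rw [not_lt] at hcon
    have hy0 : 0 < y 0 := lt_of_le_of_ne (hy 0) fun h => by
      rw [← h, zero_mul] at hcon; linarith
    have h1 : 0 < (√(y 0))⁻¹ := inv_pos.2 (Real.sqrt_pos.2 hy0)
    have h2 : y 0 * (√(y 0))⁻¹ ^ 2 = 1 := by
      rw [inv_pow, Real.sq_sqrt (hy 0), mul_inv_cancel₀ hy0.ne']
    have h3 : (√(y 0))⁻¹ ≤ γ := by
      refine le_of_pow_le_pow_left₀ two_ne_zero hγ0.le ?_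
      rw [← h2] at hcon
      exact le_of_mul_le_mul_left hcon hy0
    have h4 : g ((√(y 0))⁻¹ : ℝ) = 0 := by
      rw [hg, (tprod_one_sub_eq_zero_iff hs hy).2 ⟨0, by exact_mod_cast h2⟩, mul_zero]
    have h5 := hupos _ h1 h3
    simp only [hu, h4, Complex.zero_re] at h5
    exact lt_irrefl _ h5
  have hset : {r : ℝ | 0 < r ∧ ∀ z : ℂ, ‖z‖ < r → z ≠ 0 → 0 < (z * deriv g z / g z).re} =
      Set.Ioc 0 γ := by
    ext r
    constructor
    · rintro ⟨hr0, hr⟩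
      refine ⟨hr0, not_lt.1 fun hlt => ?_⟩
      -- A disk of radius greater than γ contains γ, where g' and hence the quotient vanish.
      have h1 := hr (γ : ℂ) (by rwa [Complex.norm_real, Real.norm_of_nonneg hγ0.le])
        (by exact_mod_cast hγ0.ne')
      rw [(hg' γ).deriv, (tprod_one_sub_eq_zero_iff hs' hx).2 ⟨0, by exact_mod_cast hγ2⟩] at h1
      simp at h1
    · rintro ⟨hr0, hr⟩
      refine ⟨hr0, fun z hz hz0 => ?_⟩
      have hnz : 0 < ‖z‖ := norm_pos_iff.2 hz0
      have hzγ : ‖z‖ < γ := hz.trans_le hr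
      have hyz : y 0 * ‖z‖ ^ 2 < 1 := by
        refine lt_of_le_of_lt (mul_le_mul_of_nonneg_left ?_ (hy 0)) hyγ
        exact pow_le_pow_left₀ hnz.le hzγ.le 2
      have hym : ∀ m, y m * ‖z ^ 2‖ < 1 := fun m => by
        rw [norm_pow]
        exact lt_of_le_of_lt (mul_le_mul_of_nonneg_right (hanti (Nat.zero_le m)) (by positivity)) hyz
      have hfun : g = fun z : ℂ => z * ∏' m, (1 - (y m : ℂ) * z ^ 2) := funext hg
      have e1 : z * deriv g z / g z = 1 - 2 * ∑' m, (y m : ℂ) * z ^ 2 / (1 - (y m : ℂ) * z ^ 2) := by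
        rw [hfun]
        exact mul_deriv_div_eq hs hy hanti hz0 hyz
      have e2 : (‖z‖ : ℂ) * deriv g ‖z‖ / g ‖z‖ =
          1 - 2 * ∑' m, (y m : ℂ) * (‖z‖ : ℂ) ^ 2 / (1 - (y m : ℂ) * (‖z‖ : ℂ) ^ 2) := by
        rw [hfun]
        exact mul_deriv_div_eq hs hy hanti (by exact_mod_cast hnz.ne') (by simpa using hyz)
      have e3 : ∑' m, (y m : ℂ) * (‖z‖ : ℂ) ^ 2 / (1 - (y m : ℂ) * (‖z‖ : ℂ) ^ 2) =
          ((∑' m, y m * ‖z ^ 2‖ / (1 - y m * ‖z ^ 2‖) : ℝ) : ℂ) := by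
        rw [Complex.ofReal_tsum]
        refine tsum_congr fun m => ?_
        rw [norm_pow]
        push_cast
        rfl
      have hsr := summable_div_one_sub hs hy hanti (norm_nonneg (z ^ 2)) (hym 0)
      have hbound : ‖∑' m, (y m : ℂ) * z ^ 2 / (1 - (y m : ℂ) * z ^ 2)‖ ≤
          ∑' m, y m * ‖z ^ 2‖ / (1 - y m * ‖z ^ 2‖) :=
        tsum_of_norm_bounded hsr.hasSum fun m => norm_div_one_sub_le (hy m) (hym m)
      -- This number is |z| g'(|z|) / g(|z|), a quotient of positive reals since |z| < γ.
      have hposr : 0 < 1 - 2 * ∑' m, y m * ‖z ^ 2‖ / (1 - y m * ‖z ^ 2‖) := by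
        rw [e3, (hg' _).deriv, ofReal_tprod_one_sub hs' hx, hgr] at e2
        have e4 : ‖z‖ * (∏' m, (1 - x m * ‖z‖ ^ 2)) / u ‖z‖ =
            1 - 2 * ∑' m, y m * ‖z ^ 2‖ / (1 - y m * ‖z ^ 2‖) := by exact_mod_cast e2
        rw [← e4]
        exact div_pos (mul_pos hnz (tprod_one_sub_pos hs' (hlt _ hnz.le hzγ)))
          (hupos _ hnz hzγ.le)
      rw [e1]
      have := (Complex.re_le_norm _).trans hbound
      simp only [Complex.sub_re, Complex.one_re, Complex.mul_re, Complex.re_ofNat, Complex.im_ofNat,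
        zero_mul, sub_zero]
      linarith
  rw [starlikenessRadius, hset, csSup_Ioc hγ0]

end starlike

/-! ### Euler-Rayleigh inequalities -/

theorem pow_lt_tsum_pow {x : ℕ → ℝ} (hx : ∀ i, 0 < x i) {k : ℕ} (hs : Summable fun m => x m ^ k) :
    x 0 ^ k < ∑' m, x m ^ k := by
  have h := hs.sum_le_tsum (Finset.range 2) fun m _ => pow_nonneg (hx m).le k
  have := pow_pos (hx 1) k
  simp [Finset.sum_range_succ] at h
  linarith

/-- Termwise x_m^(k+1) ≤ x_0 x_m^k, strictly for some m because x_m tends to 0 while x_0 > 0. -/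
theorem tsum_pow_succ_lt {x : ℕ → ℝ} (hx : ∀ i, 0 < x i) (hanti : Antitone x) {k : ℕ}
    (hs0 : Summable x) (hs : Summable fun m => x m ^ k) (hs' : Summable fun m => x m ^ (k + 1)) :
    ∑' m, x m ^ (k + 1) < x 0 * ∑' m, x m ^ k := by
  obtain ⟨m, hm⟩ := (hs0.tendsto_atTop_zero.eventually_lt_const (hx 0)).exists
  rw [← tsum_mul_left]
  refine Summable.tsum_lt_tsum (i := m) (fun n => ?_) ?_ hs' (hs.mul_left _)
  · rw [pow_succ']
    exact mul_le_mul_of_nonneg_right (hanti (Nat.zero_le n)) (pow_nonneg (hx n).le k)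
  · rw [pow_succ']
    exact mul_lt_mul_of_pos_right hm (pow_pos (hx m) k)

/-! ### The zeros of the normalized Hahn-Exton function and of its derivative -/

section zeros

variable {b q : ℝ}

/-- The parameters of the Gaussian majorant of the Taylor coefficients. -/
theorem majorant_params (hb : b < 1) (hq0 : 0 < q) (hq1 : q < 1) :
    0 ≤ 1 / ((1 - q) * (1 - b)) ∧ 0 < √q ∧ √q < 1 := by
  have h1 : 0 < 1 - q := by linarith
  have h2 : 0 < 1 - b := by linarith
  refine ⟨by positivity, Real.sqrt_pos.2 hq0, ?_⟩
  rw [Real.sqrt_lt' one_pos]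
  simpa using hq1

theorem abs_besselCoeff_le (hb0 : 0 < b) (hb : b < 1) (hq0 : 0 < q) (hq1 : q < 1) (n : ℕ) :
    |besselCoeff b q n| ≤ (1 / ((1 - q) * (1 - b))) ^ n * √q ^ (n * (n + 1)) :=
  abs_coeff_limit_le (A := fun N n => (scaledWallPoly b q N).coeff n)
    (fun N n => abs_coeff_scaledWallPoly_le hb0 hb hq0 hq1 N n)
    (tendsto_coeff_scaledWallPoly b hq0 hq1) n

theorem exists_tprod_besselCoeff (hb0 : 0 < b) (hb : b < 1) (hq0 : 0 < q) (hq1 : q < 1) :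
    ∃ y : ℕ → ℝ, Antitone y ∧ (∀ i, 0 ≤ y i) ∧ Summable y ∧
      ∀ w : ℂ, ∑' n, ((besselCoeff b q n : ℝ) : ℂ) * w ^ n = ∏' m, (1 - (y m : ℂ) * w) := by
  obtain ⟨hD, hρ0, hρ1⟩ := majorant_params hb hq0 hq1
  obtain ⟨y, h1, h2, h3, h4, -⟩ := exists_tprod_of_tendsto_coeff (scaledWallPoly b q)
    (besselCoeff b q) hD hρ0 hρ1 (coeff_zero_scaledWallPoly b hq0)
    (fun N w hw => scaledWallPoly_roots hb0 hb hq0 hq1 N hw)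
    (abs_coeff_scaledWallPoly_le hb0 hb hq0 hq1) (tendsto_coeff_scaledWallPoly b hq0 hq1)
  exact ⟨y, h1, h2, h3, h4⟩

theorem abs_coeff_oddDerivative_le (hb0 : 0 < b) (hb : b < 1) (hq0 : 0 < q) (hq1 : q < 1)
    (N n : ℕ) : |(oddDerivative (scaledWallPoly b q N)).coeff n| ≤
      (3 * (1 / ((1 - q) * (1 - b)))) ^ n * √q ^ (n * (n + 1)) := by
  rw [coeff_oddDerivative]
  exact abs_mul_two_mul_add_one_le (abs_coeff_scaledWallPoly_le hb0 hb hq0 hq1 N n)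

theorem tendsto_coeff_oddDerivative (hq0 : 0 < q) (hq1 : q < 1) (n : ℕ) :
    Tendsto (fun N => (oddDerivative (scaledWallPoly b q N)).coeff n) atTop
      (𝓝 ((2 * n + 1) * besselCoeff b q n)) := by
  simp_rw [coeff_oddDerivative]
  exact (tendsto_coeff_scaledWallPoly b hq0 hq1 n).const_mul _

theorem exists_tprod_deriv_besselCoeff (hb0 : 0 < b) (hb : b < 1) (hq0 : 0 < q) (hq1 : q < 1) :
    ∃ x : ℕ → ℝ, Antitone x ∧ (∀ i, 0 < x i) ∧ Summable x ∧
      (∀ w : ℂ, ∑' n : ℕ, (((2 * n + 1) * besselCoeff b q n : ℝ) : ℂ) * w ^ n =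
        ∏' m, (1 - (x m : ℂ) * w)) ∧
      ∑' m, x m = - (3 * besselCoeff b q 1) ∧
      ∑' m, x m ^ 2 = (3 * besselCoeff b q 1) ^ 2 - 2 * (5 * besselCoeff b q 2) ∧
      ∑' m, x m ^ 3 = - (3 * besselCoeff b q 1) ^ 3 +
        3 * (3 * besselCoeff b q 1) * (5 * besselCoeff b q 2) - 3 * (7 * besselCoeff b q 3) := by
  obtain ⟨hD, hρ0, hρ1⟩ := majorant_params hb hq0 hq1
  have hD3 : 0 ≤ 3 * (1 / ((1 - q) * (1 - b))) := by linarith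
  obtain ⟨x, h1, h2, h3, h4, h5, h6, h7⟩ := exists_tprod_of_tendsto_coeff
    (fun N => oddDerivative (scaledWallPoly b q N)) (fun n => (2 * n + 1) * besselCoeff b q n)
    hD3 hρ0 hρ1
    (fun N => by
      rw [coeff_oddDerivative, coeff_zero_scaledWallPoly b hq0]; simp)
    (fun N w hw => oddDerivative_roots (coeff_zero_scaledWallPoly b hq0 N)
      (fun w hw => scaledWallPoly_roots hb0 hb hq0 hq1 N hw) hw)
    (abs_coeff_oddDerivative_le hb0 hb hq0 hq1) (tendsto_coeff_oddDerivative hq0 hq1)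
  have hpos : ∀ i, 0 < x i := by
    refine exists_pos_factor_of_alternating (a := fun n => (2 * n + 1) * besselCoeff b q n) h2 h1
      (fun n => ?_) (fun w => ?_) h4
    · rw [mul_left_comm]
      exact mul_pos (by positivity) (sign_besselCoeff_pos hb hq0 hq1 n)
    · refine Summable.of_norm_bounded
        (summable_pow_mul_pow_mul_succ hD3 hρ0 hρ1 (norm_nonneg w)) fun n => ?_
      rw [norm_mul, Complex.norm_real, norm_pow, Real.norm_eq_abs]
      exact mul_le_mul_of_nonneg_right
        (abs_mul_two_mul_add_one_le (abs_besselCoeff_le hb0 hb hq0 hq1 n)) (by positivity)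
  refine ⟨x, h1, hpos, h3, h4, ?_, ?_, ?_⟩
  · rw [h5]; norm_num
  · rw [h6]; norm_num
  · rw [h7]; norm_num

theorem besselCoeff_one (b q : ℝ) : besselCoeff b q 1 = -q / ((1 - q) * (1 - b)) := by
  simp [besselCoeff, qPoch]

theorem besselCoeff_two (b q : ℝ) : besselCoeff b q 2 =
    q ^ 3 / ((1 - q) * (1 - q ^ 2) * ((1 - b) * (1 - b * q))) := by
  simp [besselCoeff, qPoch, Finset.prod_range_succ, pow_two]

theorem besselCoeff_three (b q : ℝ) : besselCoeff b q 3 =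
    -q ^ 6 / ((1 - q) * (1 - q ^ 2) * (1 - q ^ 3) * ((1 - b) * (1 - b * q) * (1 - b * q ^ 2))) := by
  rw [besselCoeff]
  simp only [qPoch, Finset.prod_range_succ, Finset.prod_range_zero]
  norm_num
  ring

end zeros

/-! ### The derivative of g and the critical-point equation -/

section main

variable {ν q : ℝ}

theorem hasDerivAt_gThree (hν : -1 < ν) (hq0 : 0 < q) (hq1 : q < 1) (z : ℂ) :
    HasDerivAt (gThree ν q) (∑' n : ℕ,
      (((2 * n + 1) * besselCoeff (q ^ (ν + 1)) q n : ℝ) : ℂ) * (z ^ 2) ^ n) z := by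
  obtain ⟨hb0, hb⟩ := rpow_add_one_mem hν hq0 hq1
  obtain ⟨hD, hρ0, hρ1⟩ := majorant_params hb hq0 hq1
  rw [funext (gThree_eq_tsum hν hq0 hq1)]
  exact hasDerivAt_mul_tsum_sq hD hρ0 hρ1 (abs_besselCoeff_le hb0 hb hq0 hq1) z

theorem laguerrePolya_deriv_gThree (hν : -1 < ν) (hq0 : 0 < q) (hq1 : q < 1) :
    LaguerrePolya (deriv (gThree ν q)) := by
  obtain ⟨hb0, hb⟩ := rpow_add_one_mem hν hq0 hq1
  obtain ⟨hD, hρ0, hρ1⟩ := majorant_params hb hq0 hq1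
  refine ⟨fun N => (oddDerivative (scaledWallPoly (q ^ (ν + 1)) q N)).comp (Polynomial.X ^ 2),
    fun N z hz => oddDerivative_comp_sq_real_rooted (coeff_zero_scaledWallPoly _ hq0 N)
      (fun w hw => scaledWallPoly_roots hb0 hb hq0 hq1 N hw) hz, ?_⟩
  have h := tendstoLocallyUniformly_tsum_coeff (by linarith) hρ0 hρ1
    (abs_coeff_oddDerivative_le hb0 hb hq0 hq1) (tendsto_coeff_oddDerivative hq0 hq1)
  have e1 : (fun (N : ℕ) (z : ℂ) => Polynomial.aeval z
      ((oddDerivative (scaledWallPoly (q ^ (ν + 1)) q N)).comp (Polynomial.X ^ 2))) =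
      fun N z => ∑' n,
        (((oddDerivative (scaledWallPoly (q ^ (ν + 1)) q N)).coeff n : ℝ) : ℂ) * (z ^ 2) ^ n := by
    funext N z
    rw [Polynomial.aeval_comp, map_pow, Polynomial.aeval_X, aeval_eq_tsum_coeff]
  have e2 : deriv (gThree ν q) = fun z => ∑' n : ℕ,
      (((2 * n + 1) * besselCoeff (q ^ (ν + 1)) q n : ℝ) : ℂ) * (z ^ 2) ^ n :=
    funext fun z => (hasDerivAt_gThree hν hq0 hq1 z).deriv
  rw [e1, e2]
  exact h

/-- On the positive axis the equation `r J' = (ν - 1) J` describes the critical points of the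
normalized function. -/
theorem mul_deriv_hahnExtonJ_sub_eq_zero_iff (hν : -1 < ν) (hq0 : 0 < q) (hq1 : q < 1) {r : ℝ}
    (hr : 0 < r) :
    (r : ℂ) * deriv (hahnExtonJ ν q) (r : ℂ) - ((ν - 1 : ℝ) : ℂ) * hahnExtonJ ν q (r : ℂ) = 0 ↔
      deriv (gThree ν q) (r : ℂ) = 0 := by
  have hr0 : (r : ℂ) ≠ 0 := by exact_mod_cast hr.ne'
  have hc : (cNu ν q : ℂ) ≠ 0 := by exact_mod_cast cNu_ne_zero hν hq0 hq1
  have hg := (hasDerivAt_gThree hν hq0 hq1 (r : ℂ)).differentiableAt.hasDerivAt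
  have hp : HasDerivAt (fun z : ℂ => z ^ (((ν - 1 : ℝ)) : ℂ))
      ((((ν - 1 : ℝ)) : ℂ) * (r : ℂ) ^ ((((ν - 1 : ℝ)) : ℂ) - 1)) (r : ℂ) :=
    by simpa only [id, mul_one] using (hasDerivAt_id (r : ℂ)).cpow_const
        (c := (((ν - 1 : ℝ)) : ℂ)) (Complex.ofReal_mem_slitPlane.2 hr)
  have hJ : HasDerivAt (hahnExtonJ ν q) ((cNu ν q : ℂ)⁻¹ *
      ((((ν - 1 : ℝ)) : ℂ) * (r : ℂ) ^ ((((ν - 1 : ℝ)) : ℂ) - 1) * gThree ν q r +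
        (r : ℂ) ^ (((ν - 1 : ℝ)) : ℂ) * deriv (gThree ν q) r)) (r : ℂ) := by
    refine ((hp.mul hg).const_mul (cNu ν q : ℂ)⁻¹).congr_of_eventuallyEq ?_
    filter_upwards [isOpen_ne.mem_nhds hr0] with z hz
    exact hahnExtonJ_eq hν hq0 hq1 hz
  have hpow : (r : ℂ) ^ (((ν - 1 : ℝ)) : ℂ) ≠ 0 := by
    rw [Ne, Complex.cpow_eq_zero_iff]
    exact fun h => hr0 h.1
  -- Differentiating J = c⁻¹ z^(ν-1) g, the term (ν - 1) J cancels and c⁻¹ r · r^(ν-1) g'(r)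
  -- remains.
  have e : (r : ℂ) * deriv (hahnExtonJ ν q) (r : ℂ) - ((ν - 1 : ℝ) : ℂ) * hahnExtonJ ν q (r : ℂ) =
      (cNu ν q : ℂ)⁻¹ * r * (r : ℂ) ^ (((ν - 1 : ℝ)) : ℂ) * deriv (gThree ν q) r := by
    rw [hJ.deriv, hahnExtonJ_eq hν hq0 hq1 hr0, Complex.cpow_sub _ _ hr0, Complex.cpow_one]
    field_simp
    ring
  rw [e, mul_eq_zero, or_iff_right]
  exact mul_ne_zero (mul_ne_zero (inv_ne_zero hc) hr0) hpow

end main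

/-! ### Closed forms of the Euler–Rayleigh sums and their quotients, with b = q^(ν+1) -/

section algebra

variable {b q : ℝ}

theorem euler_rayleigh_denominator_neg (hb0 : 0 < b) (hb : b < 1) (hq0 : 0 < q) (hq1 : q < 1) :
    9 * (b * q ^ 2) - b * q + q - 9 < 0 := by
  have h1 : b * q ^ 2 < q ^ 2 := mul_lt_of_lt_one_left (by positivity) hb
  have h2 : 0 < b * q := by positivity
  nlinarith

theorem euler_rayleigh_sum_two (hb0 : 0 < b) (hb : b < 1) (hq0 : 0 < q) (hq1 : q < 1) :
    (3 * besselCoeff b q 1) ^ 2 - 2 * (5 * besselCoeff b q 2) =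
      q ^ 2 * (9 * (b * q ^ 2) - b * q + q - 9) /
        ((b - 1) ^ 2 * (b * q - 1) * (q - 1) ^ 2 * (q + 1)) := by
  have h1 : 1 - q ≠ 0 := by linarith
  have h2 : 1 - b ≠ 0 := by linarith
  have h3 : 1 - b * q ≠ 0 := by nlinarith
  have h4 : 1 + q ≠ 0 := by linarith
  have e1 : (b - 1) ^ 2 * (b * q - 1) * (q - 1) ^ 2 * (q + 1) =
      -((1 - b) ^ 2 * (1 - b * q) * (1 - q) ^ 2 * (1 + q)) := by ring
  have e2 : 1 - q ^ 2 = (1 - q) * (1 + q) := by ring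
  rw [besselCoeff_one, besselCoeff_two, e1, e2, div_neg]
  -- The nonzero factors become atoms, so that clearing denominators does not expand them; they are
  -- restored for the final polynomial identity.
  generalize hu : 1 - q = u at *
  generalize hv : 1 - b = v at *
  generalize hw : 1 - b * q = w at *
  generalize hs : 1 + q = s at *
  field_simp
  subst hu hv hw hs
  ring

theorem euler_rayleigh_sum_three (hb0 : 0 < b) (hb : b < 1) (hq0 : 0 < q) (hq1 : q < 1) :
    - (3 * besselCoeff b q 1) ^ 3 +
        3 * (3 * besselCoeff b q 1) * (5 * besselCoeff b q 2) - 3 * (7 * besselCoeff b q 3) =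
      3 * q ^ 3 * ((6 * (b * q) - 12 * (b * q ^ 2) - 20 * (b * q ^ 3) - 12 * (b * q ^ 4) +
        6 * (b * q ^ 5) + b ^ 2 * q ^ 3) + (3 * (b ^ 2 * q ^ 4) + 3 * (b ^ 2 * q ^ 5) +
        9 * (b ^ 2 * q ^ 6) + q ^ 3 + 3 * q ^ 2 + 3 * q + 9)) /
        ((b - 1) ^ 3 * (b * q - 1) * (b * q ^ 2 - 1) * (q - 1) ^ 3 *
          (q ^ 3 + 2 * q ^ 2 + 2 * q + 1)) := by
  have h1 : 1 - q ≠ 0 := by linarith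
  have h2 : 1 - b ≠ 0 := by linarith
  have hbq : b * q < 1 := by nlinarith
  have h3 : 1 - b * q ≠ 0 := by linarith
  have h4 : 1 + q ≠ 0 := by linarith
  have h5 : 1 - b * q ^ 2 ≠ 0 := by nlinarith
  have h6 : 1 + q + q ^ 2 ≠ 0 := by positivity
  have e1 : (b - 1) ^ 3 * (b * q - 1) * (b * q ^ 2 - 1) * (q - 1) ^ 3 *
      (q ^ 3 + 2 * q ^ 2 + 2 * q + 1) =
      (1 - b) ^ 3 * (1 - b * q) * (1 - b * q ^ 2) * (1 - q) ^ 3 * ((1 + q) * (1 + q + q ^ 2)) := by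
    ring
  have e2 : 1 - q ^ 2 = (1 - q) * (1 + q) := by ring
  have e3 : 1 - q ^ 3 = (1 - q) * (1 + q + q ^ 2) := by ring
  rw [besselCoeff_one, besselCoeff_two, besselCoeff_three, e1, e2, e3]
  generalize hu : 1 - q = u at *
  generalize hv : 1 - b = v at *
  generalize hw : 1 - b * q = w at *
  generalize ht : 1 - b * q ^ 2 = t at *
  generalize hs : 1 + q + q ^ 2 = s at *
  generalize hp : 1 + q = p at *
  field_simp
  subst hs hp hu hv hw ht
  ring

/-- This is S_1/S_2, the upper bound for the square of the radius; `euler_rayleigh_quotient_two` is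
S_2/S_3, with s in the place of `qThreeStar ν q`. -/
theorem euler_rayleigh_quotient_one (hb0 : 0 < b) (hb : b < 1) (hq0 : 0 < q) (hq1 : q < 1) :
    3 * q / ((1 - q) * (1 - b)) / (q ^ 2 * (9 * (b * q ^ 2) - b * q + q - 9) /
      ((b - 1) ^ 2 * (b * q - 1) * (q - 1) ^ 2 * (q + 1))) =
    3 * (b - 1) * (b * q - 1) * (q ^ 2 - 1) / (q * (9 * (b * q ^ 2) - b * q + q - 9)) := by
  have hD := (euler_rayleigh_denominator_neg hb0 hb hq0 hq1).ne
  have h1 : q - 1 ≠ 0 := by linarith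
  have h2 : b - 1 ≠ 0 := by linarith
  have e1 : (1 - q) * (1 - b) = (q - 1) * (b - 1) := by ring
  have e2 : q ^ 2 - 1 = (q - 1) * (q + 1) := by ring
  rw [e1, e2]
  generalize 9 * (b * q ^ 2) - b * q + q - 9 = d at *
  generalize q - 1 = u at *
  generalize b - 1 = v at *
  field_simp

theorem euler_rayleigh_quotient_two (hb0 : 0 < b) (hb : b < 1) (hq0 : 0 < q) (hq1 : q < 1)
    (s : ℝ) :
    q ^ 2 * (9 * (b * q ^ 2) - b * q + q - 9) /
        ((b - 1) ^ 2 * (b * q - 1) * (q - 1) ^ 2 * (q + 1)) /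
      (3 * q ^ 3 * (9 * (b * q ^ 2) - b * q + q - 9) /
        ((b - 1) ^ 3 * (b * q - 1) * (b * q ^ 2 - 1) * (q - 1) ^ 3 * s)) =
    (q - 1) * (b - 1) * (b * q ^ 2 - 1) / (3 * q * (q + 1)) * s := by
  have hD := (euler_rayleigh_denominator_neg hb0 hb hq0 hq1).ne
  have h1 : q - 1 ≠ 0 := by linarith
  have h2 : b - 1 ≠ 0 := by linarith
  have h3 : b * q - 1 ≠ 0 := by nlinarith
  -- Inverting the inner fraction is valid even if its denominator is 0, so s needs no nonvanishing
  -- hypothesis.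
  rw [div_div_eq_mul_div]
  generalize 9 * (b * q ^ 2) - b * q + q - 9 = d at *
  generalize b * q ^ 2 - 1 = t at *
  generalize b * q - 1 = w at *
  generalize q - 1 = u at *
  generalize b - 1 = v at *
  field_simp

end algebra

/-! ### Reduction to powers of q^(ν+1), and the main theorem -/

theorem rpow_add_eq {q : ℝ} (hq0 : 0 < q) {ν μ : ℝ} (m : ℕ) (h : μ = ν + 1 + m) :
    q ^ μ = q ^ (ν + 1) * q ^ m := by
  rw [h, Real.rpow_add_natCast hq0.ne']

theorem rpow_two_mul_add_eq {q : ℝ} (hq0 : 0 < q) {ν μ : ℝ} (m : ℕ)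
    (h : μ = (ν + 1) + (ν + 1) + m) : q ^ μ = (q ^ (ν + 1)) ^ 2 * q ^ m := by
  rw [h, Real.rpow_add_natCast hq0.ne', Real.rpow_add hq0, pow_two]

theorem lt_sqrt_div_of_mul_lt {a S T : ℝ} (ha : 0 < a) (hT : 0 < T) (h : T < a * S) :
    (√a)⁻¹ < √(S / T) := by
  rw [← Real.sqrt_inv]
  refine Real.sqrt_lt_sqrt (by positivity) ?_
  rwa [lt_div_iff₀ hT, inv_mul_lt_iff₀ ha]

theorem theorem5 (ν q : ℝ) (hν : -1 < ν) (hq0 : 0 < q) (hq1 : q < 1) :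
    -- the radius of starlikeness is the smallest positive root
    IsLeast {r : ℝ | 0 < r ∧
        (r : ℂ) * deriv (hahnExtonJ ν q) (r : ℂ) - ((ν - 1 : ℝ) : ℂ) * hahnExtonJ ν q (r : ℂ) = 0}
      (starlikenessRadius (gThree ν q)) ∧
    -- first pair of bounds
    √((1 - q) * (1 - q ^ (ν + 1)) / (3 * q)) < starlikenessRadius (gThree ν q) ∧
    starlikenessRadius (gThree ν q) <
      √(3 * (q ^ (ν + 1) - 1) * (q ^ (ν + 2) - 1) * (q ^ 2 - 1) /
        (q * (9 * q ^ (ν + 3) - q ^ (ν + 2) + q - 9))) ∧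
    -- second pair of bounds
    ((q ^ (ν + 1) - 1) ^ 2 * (q - 1) ^ 2 * (q ^ (ν + 2) - 1) * (q + 1) /
        (q ^ 2 * (9 * q ^ (ν + 3) - q ^ (ν + 2) + q - 9))) ^ (1 / 4 : ℝ) <
      starlikenessRadius (gThree ν q) ∧
    starlikenessRadius (gThree ν q) <
      √((q - 1) * (q ^ (ν + 1) - 1) * (q ^ (ν + 3) - 1) / (3 * q * (q + 1)) * qThreeStar ν q) ∧
    -- the derivative of the normalized function and its Euler-Rayleigh sums
    LaguerrePolya (deriv (gThree ν q)) ∧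
    HasEulerRayleighSum (deriv (gThree ν q)) 1 (3 * q / ((1 - q) * (1 - q ^ (ν + 1)))) ∧
    HasEulerRayleighSum (deriv (gThree ν q)) 2
      (q ^ 2 * (9 * q ^ (ν + 3) - q ^ (ν + 2) + q - 9) /
        ((q ^ (ν + 1) - 1) ^ 2 * (q ^ (ν + 2) - 1) * (q - 1) ^ 2 * (q + 1))) ∧
    HasEulerRayleighSum (deriv (gThree ν q)) 3
      (3 * q ^ 3 * (9 * q ^ (ν + 3) - q ^ (ν + 2) + q - 9) /
        ((q ^ (ν + 1) - 1) ^ 3 * (q ^ (ν + 2) - 1) * (q ^ (ν + 3) - 1) * (q - 1) ^ 3 *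
          qThreeStar ν q)) := by
  obtain ⟨hb0, hb⟩ := rpow_add_one_mem hν hq0 hq1
  have r2 : q ^ (ν + 2) = q ^ (ν + 1) * q := by
    rw [rpow_add_eq hq0 (ν := ν) 1 (by push_cast; ring), pow_one]
  have r3 : q ^ (ν + 3) = q ^ (ν + 1) * q ^ 2 := rpow_add_eq hq0 2 (by push_cast; ring)
  have r4 : q ^ (ν + 4) = q ^ (ν + 1) * q ^ 3 := rpow_add_eq hq0 3 (by push_cast; ring)
  have r5 : q ^ (ν + 5) = q ^ (ν + 1) * q ^ 4 := rpow_add_eq hq0 4 (by push_cast; ring)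
  have r6 : q ^ (ν + 6) = q ^ (ν + 1) * q ^ 5 := rpow_add_eq hq0 5 (by push_cast; ring)
  have t5 : q ^ (2 * ν + 5) = (q ^ (ν + 1)) ^ 2 * q ^ 3 :=
    rpow_two_mul_add_eq hq0 3 (by push_cast; ring)
  have t6 : q ^ (2 * ν + 6) = (q ^ (ν + 1)) ^ 2 * q ^ 4 :=
    rpow_two_mul_add_eq hq0 4 (by push_cast; ring)
  have t7 : q ^ (2 * ν + 7) = (q ^ (ν + 1)) ^ 2 * q ^ 5 :=
    rpow_two_mul_add_eq hq0 5 (by push_cast; ring)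
  have t8 : q ^ (2 * ν + 8) = (q ^ (ν + 1)) ^ 2 * q ^ 6 :=
    rpow_two_mul_add_eq hq0 6 (by push_cast; ring)
  have hstar : qThreeStar ν q = (9 * (q ^ (ν + 1) * q ^ 2) - q ^ (ν + 1) * q + q - 9) *
      (q ^ 3 + 2 * q ^ 2 + 2 * q + 1) / (sNu ν q + rNu ν q) := by
    rw [qThreeStar, r2, r3]
  have hsr : sNu ν q + rNu ν q = (6 * (q ^ (ν + 1) * q) - 12 * (q ^ (ν + 1) * q ^ 2) -
      20 * (q ^ (ν + 1) * q ^ 3) - 12 * (q ^ (ν + 1) * q ^ 4) + 6 * (q ^ (ν + 1) * q ^ 5) +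
      (q ^ (ν + 1)) ^ 2 * q ^ 3) + (3 * ((q ^ (ν + 1)) ^ 2 * q ^ 4) +
      3 * ((q ^ (ν + 1)) ^ 2 * q ^ 5) + 9 * ((q ^ (ν + 1)) ^ 2 * q ^ 6) +
      q ^ 3 + 3 * q ^ 2 + 3 * q + 9) := by
    rw [sNu, rNu, r2, r3, r4, r5, r6, t5, t6, t7, t8]
  rw [r2, r3]
  obtain ⟨y, hyanti, hy0, hys, hyprod⟩ := exists_tprod_besselCoeff hb0 hb hq0 hq1
  obtain ⟨x, hxanti, hxpos, hxs, hxprod, hS1, hS2, hS3⟩ :=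
    exists_tprod_deriv_besselCoeff hb0 hb hq0 hq1
  rw [besselCoeff_one] at hS1
  rw [euler_rayleigh_sum_two hb0 hb hq0 hq1] at hS2
  rw [euler_rayleigh_sum_three hb0 hb hq0 hq1, ← hsr] at hS3
  have hDneg := euler_rayleigh_denominator_neg hb0 hb hq0 hq1
  have hquot := euler_rayleigh_quotient_one hb0 hb hq0 hq1
  have hquot' := euler_rayleigh_quotient_two hb0 hb hq0 hq1 (qThreeStar ν q)
  set b := q ^ (ν + 1) with hbdef
  have hS1' : ∑' m, x m = 3 * q / ((1 - q) * (1 - b)) := by rw [hS1]; ring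
  have hS3' : ∑' m, x m ^ 3 = 3 * q ^ 3 * (9 * (b * q ^ 2) - b * q + q - 9) /
      ((b - 1) ^ 3 * (b * q - 1) * (b * q ^ 2 - 1) * (q - 1) ^ 3 * qThreeStar ν q) := by
    rw [hS3, hstar]
    -- The factor d also occurs in the numerator of `qThreeStar ν q`, so it cancels from the stated
    -- form of S_3.
    generalize 9 * (b * q ^ 2) - b * q + q - 9 = d at hDneg ⊢
    rw [← mul_div_assoc, div_div_eq_mul_div, mul_left_comm _ d, mul_right_comm _ d, mul_comm d,
      mul_div_mul_right _ _ hDneg.ne]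
  have hx0 : ∀ i, 0 ≤ x i := fun i => (hxpos i).le
  have hpow : ∀ k, Summable fun m => x m ^ (k + 1) := fun k => by
    refine Summable.of_nonneg_of_le (fun m => pow_nonneg (hx0 m) _) (fun m => ?_)
      (hxs.mul_left (x 0 ^ k))
    rw [pow_succ]
    exact mul_le_mul_of_nonneg_right (pow_le_pow_left₀ (hx0 m) (hxanti (Nat.zero_le m)) k) (hx0 m)
  have hg : ∀ z, gThree ν q z = z * ∏' m, (1 - (y m : ℂ) * z ^ 2) := fun z => by
    rw [gThree_eq_tsum hν hq0 hq1, hyprod]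
  have hg' : ∀ z, HasDerivAt (gThree ν q) (∏' m, (1 - (x m : ℂ) * z ^ 2)) z := fun z => by
    rw [← hxprod]
    exact hasDerivAt_gThree hν hq0 hq1 z
  have hderiv : deriv (gThree ν q) = fun z => ∏' m, (1 - (x m : ℂ) * z ^ 2) :=
    funext fun z => (hg' z).deriv
  have hrad := starlikenessRadius_eq hys hy0 hyanti hxs hx0 hxanti (hxpos 0) hg hg'
  have hroot : ∀ r : ℝ, deriv (gThree ν q) (r : ℂ) = 0 ↔ ∃ m, x m * r ^ 2 = 1 := fun r => by
    rw [hderiv]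
    simp only
    rw [tprod_one_sub_eq_zero_iff hxs hx0]
    norm_cast
  have hsqrt : 0 < √(x 0) := Real.sqrt_pos.2 (hxpos 0)
  have hS2pos : 0 < ∑' m, x m ^ 2 := (hpow 1).tsum_pos (fun m => pow_nonneg (hx0 m) _) 0
    (pow_pos (hxpos 0) _)
  have hS3pos : 0 < ∑' m, x m ^ 3 := (hpow 2).tsum_pos (fun m => pow_nonneg (hx0 m) _) 0
    (pow_pos (hxpos 0) _)
  have hlow1 : x 0 < ∑' m, x m := by
    simpa using pow_lt_tsum_pow hxpos (k := 1) (by simpa using hxs)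
  have hlow2 : x 0 ^ 2 < ∑' m, x m ^ 2 := pow_lt_tsum_pow hxpos (hpow 1)
  have hup1 : ∑' m, x m ^ 2 < x 0 * ∑' m, x m := by
    simpa using tsum_pow_succ_lt hxpos hxanti (k := 1) hxs (by simpa using hxs) (hpow 1)
  have hup2 : ∑' m, x m ^ 3 < x 0 * ∑' m, x m ^ 2 :=
    tsum_pow_succ_lt hxpos hxanti hxs (hpow 1) (hpow 2)
  refine ⟨⟨⟨?_, ?_⟩, ?_⟩, ?_, ?_, ?_, ?_, laguerrePolya_deriv_gThree hν hq0 hq1, ?_, ?_, ?_⟩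
  · rw [hrad]
    exact inv_pos.2 hsqrt
  · rw [hrad, mul_deriv_hahnExtonJ_sub_eq_zero_iff hν hq0 hq1 (inv_pos.2 hsqrt), hroot]
    exact ⟨0, by rw [inv_pow, Real.sq_sqrt (hx0 0), mul_inv_cancel₀ (hxpos 0).ne']⟩
  · rintro r ⟨hr0, hr⟩
    rw [mul_deriv_hahnExtonJ_sub_eq_zero_iff hν hq0 hq1 hr0, hroot] at hr
    obtain ⟨m, hm⟩ := hr
    rw [hrad, inv_le_comm₀ hsqrt hr0, ← one_div, div_le_iff₀ hr0]
    refine le_of_pow_le_pow_left₀ two_ne_zero (by positivity) ?_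
    rw [mul_pow, Real.sq_sqrt (hx0 0), one_pow, ← hm]
    exact mul_le_mul_of_nonneg_right (hxanti (Nat.zero_le m)) (sq_nonneg r)
  · rw [hrad, ← inv_div, ← hS1', Real.sqrt_inv]
    exact (inv_lt_inv₀ (Real.sqrt_pos.2 ((hxpos 0).trans hlow1)) hsqrt).2
      (Real.sqrt_lt_sqrt (hx0 0) hlow1)
  · rw [hrad, ← hquot, ← hS1', ← hS2]
    exact lt_sqrt_div_of_mul_lt (hxpos 0) hS2pos hup1
  · have e : (b - 1) ^ 2 * (q - 1) ^ 2 * (b * q - 1) * (q + 1) /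
        (q ^ 2 * (9 * (b * q ^ 2) - b * q + q - 9)) = (∑' m, x m ^ 2)⁻¹ := by
      rw [hS2, inv_div, mul_right_comm ((b - 1) ^ 2)]
    rw [e, hrad]
    -- The inequality x_0² < S_2 in terms of r* = x_0^(-1/2), whose fourth power is x_0^(-2).
    have h1 : (∑' m, x m ^ 2)⁻¹ < (√(x 0))⁻¹ ^ 4 := by
      have : √(x 0) ^ 4 = x 0 ^ 2 := by
        rw [show 4 = 2 * 2 from rfl, pow_mul, Real.sq_sqrt (hx0 0)]
      rw [inv_pow, this]
      exact (inv_lt_inv₀ hS2pos (pow_pos (hxpos 0) 2)).2 hlow2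
    have h2 := Real.rpow_lt_rpow (inv_pos.2 hS2pos).le h1 (by norm_num : (0 : ℝ) < 1 / 4)
    have h3 : ((√(x 0))⁻¹ ^ 4) ^ (1 / 4 : ℝ) = (√(x 0))⁻¹ := by
      have := Real.pow_rpow_inv_natCast (inv_pos.2 hsqrt).le (n := 4) (by norm_num)
      rw [one_div]
      exact_mod_cast this
    rwa [h3] at h2
  · rw [hrad, ← hquot', ← hS3', ← hS2]
    exact lt_sqrt_div_of_mul_lt (hxpos 0) hS3pos hup2
  · rw [hderiv, ← hS1']
    exact hasEulerRayleighSum_tprod hxs hx0 one_ne_zero (by simpa using hxs.hasSum)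
  · rw [hderiv, ← hS2]
    exact hasEulerRayleighSum_tprod hxs hx0 two_ne_zero (hpow 1).hasSum
  · rw [hderiv, ← hS3']
    exact hasEulerRayleighSum_tprod hxs hx0 three_ne_zero (hpow 2).hasSum
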